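/- Let $p\in(1,\infty)$, $s\in(0,1)$, let $N\ge 1$ be an integer with $N>sp$, and let $\Omega\subset\mathbb R^N$ be a nonempty bounded open set (in particular, any bounded domain with Lipschitz boundary). Put $p_s^*=\dfrac{Np}{N-sp}$. For a measurable $u:\mathbb R^N\to\mathbb R$ let $$[u]_{s,p}=\Big(\int_{\mathbb R^{2N}}\frac{|u(x)-u(y)|^p}{|x-y|^{N+sp}}\,dx\,dy\Big)^{1/p},$$ let $|\cdot|_r$ denote the norm of $L^r(\mathbb R^N)$, and let $$X_p^s(\Omega)=\{u\in L^p(\mathbb R^N): [u]_{s,p}<\infty,\ u=0 \text{ a.e. in } \mathbb R^N\setminus\Omega\},$$ normed by $\|u\|=[u]_{s,p}$. Let $$S_{s,p}=\inf_{u\in X_p^s(\Omega)\setminus\{0\}}\frac{\|u\|^p}{|u|_{p_s^*}^p},$$ and, for $\lambda\in\mathbb R$, let $$I_\lambda(u)=\frac1p\|u\|^p-\frac{\lambda}{p}|u|_p^p-\frac1{p_s^*}|u|_{p_s^*}^{p_s^*},\qquad u\in X_p^s(\Omega).$$ Then for every $\lambda\in\mathbb R$ and every real $c<\dfrac sN\,S_{s,p}^{N/(sp)}$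 the functional $I_\lambda$ satisfies the Palais–Smale condition at the level $c$: every sequence $(u_j)$ in $X_p^s(\Omega)$ such that $I_\lambda(u_j)\to c$ and $I_\lambda'(u_j)\to 0$ in the dual of $X_p^s(\Omega)$ has a subsequence that converges in $X_p^s(\Omega)$. -/

import Mathlib

open MeasureTheory Filter Topology
open scoped ENNReal

namespace FracPLap

/-- The Gagliardo seminorm
`[u]_{s,p} = (∫∫ |u x - u y| ^ p / |x - y| ^ (N + s p) dx dy) ^ (1 / p)`
of a function on `ℝ^N`, with values in `[0, ∞]`. -/
noncomputable def gagliardo {N : ℕ} (s p : ℝ) (u : EuclideanSpace ℝ (Fin N) → ℝ) : ℝ≥0∞ :=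
  (∫⁻ z : EuclideanSpace ℝ (Fin N) × EuclideanSpace ℝ (Fin N),
    ENNReal.ofReal (|u z.1 - u z.2| ^ p / ‖z.1 - z.2‖ ^ ((N : ℝ) + s * p))) ^ (1 / p)

/-- The difference quotient whose `L^p` norm on `ℝ^{2N}` is the Gagliardo seminorm. -/
noncomputable def diffQuot {N : ℕ} (s p : ℝ) (u : EuclideanSpace ℝ (Fin N) → ℝ) :
    EuclideanSpace ℝ (Fin N) × EuclideanSpace ℝ (Fin N) → ℝ :=
  fun z => (u z.1 - u z.2) * ‖z.1 - z.2‖ ^ (-(((N : ℝ) + s * p) / p))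

section
variable {N : ℕ} {s p : ℝ} {u v : EuclideanSpace ℝ (Fin N) → ℝ}

lemma gagliardo_eq_eLpNorm (hp : 1 < p) (u : EuclideanSpace ℝ (Fin N) → ℝ) :
    gagliardo s p u = eLpNorm (diffQuot s p u) (ENNReal.ofReal p) volume := by
  have hp0 : 0 < p := by linarith
  rw [eLpNorm_eq_lintegral_rpow_enorm_toReal (by simpa using hp0) ENNReal.ofReal_ne_top,
    ENNReal.toReal_ofReal hp0.le, gagliardo]
  congr 1
  refine lintegral_congr fun z => ?_
  rw [← ofReal_norm, ENNReal.ofReal_rpow_of_nonneg (norm_nonneg _) hp0.le]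
  congr 1
  have h0 : (0 : ℝ) ≤ ‖z.1 - z.2‖ ^ (-(((N : ℝ) + s * p) / p)) := by positivity
  rw [diffQuot, norm_mul, Real.norm_eq_abs, Real.norm_of_nonneg h0,
    Real.mul_rpow (abs_nonneg _) h0, ← Real.rpow_mul (norm_nonneg _), neg_mul,
    div_mul_cancel₀ _ hp0.ne', Real.rpow_neg (norm_nonneg _), div_eq_mul_inv]

lemma ae_fst_snd {P : EuclideanSpace ℝ (Fin N) → Prop} (h : ∀ᵐ x, P x) :
    ∀ᵐ z : EuclideanSpace ℝ (Fin N) × EuclideanSpace ℝ (Fin N), P z.1 ∧ P z.2 :=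
  (Measure.quasiMeasurePreserving_fst.ae h).and (Measure.quasiMeasurePreserving_snd.ae h)

lemma gagliardo_congr (h : u =ᵐ[volume] v) : gagliardo s p u = gagliardo s p v := by
  unfold gagliardo
  congr 1
  refine lintegral_congr_ae ?_
  filter_upwards [ae_fst_snd h] with z hz
  rw [hz.1, hz.2]

lemma aestronglyMeasurable_diffQuot (hu : AEStronglyMeasurable u volume) :
    AEStronglyMeasurable (diffQuot s p u) volume := by
  refine AEStronglyMeasurable.mul (AEStronglyMeasurable.sub ?_ ?_) ?_
  · exact hu.comp_quasiMeasurePreserving Measure.quasiMeasurePreserving_fst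
  · exact hu.comp_quasiMeasurePreserving Measure.quasiMeasurePreserving_snd
  · exact (by fun_prop : Measurable fun z : EuclideanSpace ℝ (Fin N) × EuclideanSpace ℝ (Fin N) =>
      ‖z.1 - z.2‖ ^ (-(((N : ℝ) + s * p) / p))).aestronglyMeasurable

lemma diffQuot_add : diffQuot s p (u + v) = diffQuot s p u + diffQuot s p v := by
  ext z; simp only [diffQuot, Pi.add_apply]; ring

lemma diffQuot_smul (c : ℝ) : diffQuot s p (c • u) = c • diffQuot s p u := by
  ext z; simp only [diffQuot, Pi.smul_apply, smul_eq_mul]; ring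

lemma gagliardo_add_le (hp : 1 < p) (hu : AEStronglyMeasurable u volume)
    (hv : AEStronglyMeasurable v volume) :
    gagliardo s p (u + v) ≤ gagliardo s p u + gagliardo s p v := by
  simp only [gagliardo_eq_eLpNorm hp, diffQuot_add]
  exact eLpNorm_add_le (aestronglyMeasurable_diffQuot hu) (aestronglyMeasurable_diffQuot hv)
    (by simpa using hp.le)

lemma gagliardo_smul (hp : 1 < p) (c : ℝ) :
    gagliardo s p (c • u) = ENNReal.ofReal |c| * gagliardo s p u := by
  simp only [gagliardo_eq_eLpNorm hp, diffQuot_smul, eLpNorm_const_smul, Real.enorm_eq_ofReal_abs]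

/-- A function in `L^p(ℝ^N)`, `N ≥ 1`, with vanishing Gagliardo seminorm is zero. -/
lemma ae_eq_zero_of_gagliardo_eq_zero [NeZero N] (hp : 1 < p)
    (hu : MemLp u (ENNReal.ofReal p) volume) (h : gagliardo s p u = 0) : u =ᵐ[volume] 0 := by
  have hp0 : 0 < p := by linarith
  rw [gagliardo_eq_eLpNorm hp, eLpNorm_eq_zero_iff (aestronglyMeasurable_diffQuot hu.1)
    (by simpa using hp0)] at h
  obtain ⟨x, hx⟩ := (Measure.ae_ae_of_ae_prod h).exists
  have hc : u =ᵐ[volume] fun _ => u x := by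
    filter_upwards [hx, Measure.ae_ne volume x] with y hy hyx
    simp only [diffQuot, Pi.zero_apply, mul_eq_zero] at hy
    rcases hy with hy | hy
    · linarith
    · exact absurd hy (Real.rpow_pos_of_pos (norm_pos_iff.2 (sub_ne_zero.2 hyx.symm)) _).ne'
  rw [memLp_congr_ae hc, memLp_const_iff (by simpa using hp0) ENNReal.ofReal_ne_top] at hu
  rcases hu with hu | hu
  · rw [hu] at hc; exact hc
  · have := measure_univ_of_isAddLeftInvariant (volume : Measure (EuclideanSpace ℝ (Fin N)))
    simp [this] at hu

end

/-- The space `X_p^s(Ω)` as a linear subspace of `L^p(ℝ^N)`: the (classes of) functions `u` in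
`L^p(ℝ^N)` with `[u]_{s,p} < ∞` and `u = 0` a.e. in `ℝ^N \ Ω`. -/
noncomputable def XSubmodule (N : ℕ) (s p : ℝ) [hp : Fact (1 < p)]
    (Ω : Set (EuclideanSpace ℝ (Fin N))) :
    Submodule ℝ (Lp ℝ (ENNReal.ofReal p) (volume : Measure (EuclideanSpace ℝ (Fin N)))) where
  carrier := {u | gagliardo s p u < ∞ ∧ ∀ᵐ x, x ∉ Ω → u x = 0}
  zero_mem' := by
    have h0 := Lp.coeFn_zero ℝ (ENNReal.ofReal p)
      (volume : Measure (EuclideanSpace ℝ (Fin N)))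
    refine ⟨?_, ?_⟩
    · rw [gagliardo_congr h0, ← zero_smul ℝ (0 : EuclideanSpace ℝ (Fin N) → ℝ),
        gagliardo_eq_eLpNorm hp.out, diffQuot_smul, zero_smul]
      simp
    · filter_upwards [h0] with x hx _
      simp [hx]
  add_mem' := by
    rintro u v ⟨hu, hu'⟩ ⟨hv, hv'⟩
    refine ⟨?_, ?_⟩
    · rw [gagliardo_congr (Lp.coeFn_add u v)]
      exact (gagliardo_add_le hp.out (Lp.aestronglyMeasurable u)
        (Lp.aestronglyMeasurable v)).trans_lt (ENNReal.add_lt_top.2 ⟨hu, hv⟩)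
    · filter_upwards [Lp.coeFn_add u v, hu', hv'] with x hx h1 h2 h3
      exact hx.trans (by simp [h1 h3, h2 h3])
  smul_mem' := by
    rintro c u ⟨hu, hu'⟩
    refine ⟨?_, ?_⟩
    · rw [gagliardo_congr (Lp.coeFn_smul c u), gagliardo_smul hp.out]
      exact ENNReal.mul_lt_top ENNReal.ofReal_lt_top hu
    · filter_upwards [Lp.coeFn_smul c u, hu'] with x hx h1 h3
      exact hx.trans (by simp [h1 h3])

/-- The space `X_p^s(Ω)`. It is a type of its own so that it carries the Gagliardo norm below and
not the `L^p` norm. -/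
def X (N : ℕ) (s p : ℝ) [Fact (1 < p)] (Ω : Set (EuclideanSpace ℝ (Fin N))) : Type :=
  ↥(XSubmodule N s p Ω)

section
variable {N : ℕ} {s p : ℝ} [hp : Fact (1 < p)] {Ω : Set (EuclideanSpace ℝ (Fin N))}

noncomputable instance : AddCommGroup (X N s p Ω) :=
  inferInstanceAs (AddCommGroup (XSubmodule N s p Ω))

noncomputable instance : Module ℝ (X N s p Ω) :=
  inferInstanceAs (Module ℝ (XSubmodule N s p Ω))

/-- The underlying element of `L^p(ℝ^N)`. -/
def X.toLp (u : X N s p Ω) : Lp ℝ (ENNReal.ofReal p)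
    (volume : Measure (EuclideanSpace ℝ (Fin N))) := u.1

/-- An element of `X_p^s(Ω)` as a function on `ℝ^N` (defined up to null sets). -/
noncomputable def X.toFun (u : X N s p Ω) : EuclideanSpace ℝ (Fin N) → ℝ := u.toLp

/-- The norm of `X_p^s(Ω)` is the Gagliardo seminorm. -/
noncomputable instance : Norm (X N s p Ω) := ⟨fun u => (gagliardo s p u.toFun).toReal⟩

lemma X.norm_def (u : X N s p Ω) : ‖u‖ = (gagliardo s p u.toFun).toReal := rfl

lemma X.core [NeZero N] : NormedSpace.Core ℝ (X N s p Ω) where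
  norm_nonneg _ := ENNReal.toReal_nonneg
  norm_smul c u := by
    have h : (c • u).toFun =ᵐ[volume] c • u.toFun := Lp.coeFn_smul c u.toLp
    rw [X.norm_def, X.norm_def, gagliardo_congr h, gagliardo_smul hp.out, ENNReal.toReal_mul,
      ENNReal.toReal_ofReal (abs_nonneg c), Real.norm_eq_abs]
  norm_triangle u v := by
    have h : (u + v).toFun =ᵐ[volume] u.toFun + v.toFun := Lp.coeFn_add u.toLp v.toLp
    have hu : gagliardo s p u.toFun < ∞ := u.2.1
    have hv : gagliardo s p v.toFun < ∞ := v.2.1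
    rw [X.norm_def, X.norm_def, X.norm_def, gagliardo_congr h,
      ← ENNReal.toReal_add hu.ne hv.ne]
    exact ENNReal.toReal_mono (ENNReal.add_lt_top.2 ⟨hu, hv⟩).ne
      (gagliardo_add_le hp.out (Lp.aestronglyMeasurable u.toLp) (Lp.aestronglyMeasurable v.toLp))
  norm_eq_zero_iff u := by
    have hu : gagliardo s p u.toFun < ∞ := u.2.1
    constructor
    · intro h
      have h0 : gagliardo s p u.toFun = 0 :=
        ((ENNReal.toReal_eq_zero_iff _).1 h).resolve_right hu.ne
      exact Subtype.ext ((Lp.eq_zero_iff_ae_eq_zero).2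
        (ae_eq_zero_of_gagliardo_eq_zero hp.out (Lp.memLp u.toLp) h0))
    · rintro rfl
      have h : (0 : X N s p Ω).toFun =ᵐ[volume] (0 : ℝ) • (0 : EuclideanSpace ℝ (Fin N) → ℝ) := by
        rw [zero_smul]
        exact Lp.coeFn_zero _ _ _
      rw [X.norm_def, gagliardo_congr h, gagliardo_smul hp.out]
      simp

noncomputable instance [NeZero N] : NormedAddCommGroup (X N s p Ω) :=
  NormedAddCommGroup.ofCore X.core

noncomputable instance [NeZero N] : NormedSpace ℝ (X N s p Ω) :=
  NormedSpace.ofCore X.core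

end

/-- The fractional critical Sobolev exponent `p_s^* = N p / (N - s p)`. -/
noncomputable def critExp (N : ℕ) (s p : ℝ) : ℝ := N * p / (N - s * p)

/-- The `L^r` norm on `ℝ^N` of an element of `X_p^s(Ω)`. -/
noncomputable def X.lnorm {N : ℕ} {s p : ℝ} [Fact (1 < p)] {Ω : Set (EuclideanSpace ℝ (Fin N))}
    (r : ℝ) (u : X N s p Ω) : ℝ :=
  lpNorm u.toFun (ENNReal.ofReal r) volume

/-- The best constant `S_{s,p}`: the infimum of `‖u‖ ^ p / |u|_{p_s^*} ^ p` over the nonzero `u`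
in `X_p^s(Ω)`. -/
noncomputable def bestConst (N : ℕ) (s p : ℝ) [Fact (1 < p)]
    (Ω : Set (EuclideanSpace ℝ (Fin N))) : ℝ :=
  ⨅ u : {u : X N s p Ω // u ≠ 0}, ‖u.1‖ ^ p / (u.1.lnorm (critExp N s p)) ^ p

/-- The energy functional `I_lam` on `X_p^s(Ω)`. -/
noncomputable def energy (N : ℕ) (s p : ℝ) [Fact (1 < p)] (Ω : Set (EuclideanSpace ℝ (Fin N)))
    (lam : ℝ) (u : X N s p Ω) : ℝ :=
  1 / p * ‖u‖ ^ p - lam / p * (u.lnorm p) ^ p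
    - 1 / critExp N s p * (u.lnorm (critExp N s p)) ^ critExp N s p

/-- The Palais–Smale condition at the level `c` for a functional `Φ` on a normed space `W`: every
sequence `u` with `Φ (u j) → c` and `Φ' (u j) → 0` in the dual norm has a convergent
subsequence. -/
def SatisfiesPS {W : Type*} [NormedAddCommGroup W] [NormedSpace ℝ W] (Φ : W → ℝ) (c : ℝ) : Prop :=
  ∀ u : ℕ → W, Tendsto (fun j => Φ (u j)) atTop (𝓝 c) →
    Tendsto (fun j => fderiv ℝ Φ (u j)) atTop (𝓝 0) →
    ∃ (w : W) (φ : ℕ → ℕ), StrictMono φ ∧ Tendsto (fun j => u (φ j)) atTop (𝓝 w)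

end FracPLap

/-! Write q for the critical exponent and κ = 1/p − 1/q = s/N. The identity I(u) − I'(u)u/p =
κ|u|_q^q bounds the critical norm along a Palais–Smale sequence by an affine function of ‖u_j‖. By
Hölder on the bounded set Ω the λ term is controlled by the critical norm as well, and p > 1 then
bounds the sequence. A subsequence converges in L^p and almost everywhere to some w in the space.

Testing I'(u_j) → 0 against w gives I'(w)w = 0. The Brezis–Lieb lemma, used in L^q for u_j and in
L^p(ℝ^{2N}) for the difference quotients, then shows that ‖u_j − w‖^p and |u_j − w|_q^q have the
same limit b, with b ≤ c/κ < S^{N/(sp)}. The definition of S gives S b^{p/q} ≤ b, so that b = 0 or b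
≥ S^{N/(sp)}. Hence b = 0, which is convergence in norm.

The variational part is abstract (`satisfiesPS_of_compact`): the functional is a combination of
powers of L^r norms of T₁u, T₂u, T₃u, where T₁ is the isometry sending u to its difference quotient.
Weak limits never appear; boundedness together with a.e. convergence replaces them
(`tendsto_norm_rpow_sub`, `tendsto_lpPowDeriv_limit`). The analytic inputs are the fractional
Sobolev inequality (`exists_eLpNorm_critExp_le`) and the compact embedding into L^p
(`X.exists_subseq_tendsto`). -/

namespace FracPLap

/-! ### Pointwise inequalities for powers. -/

/-- The derivative of `|x| ^ q / q`. -/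
noncomputable def signedPow (q x : ℝ) : ℝ := |x| ^ (q - 2) * x

lemma signedPow_mul_self {q : ℝ} (hq : 1 < q) (x : ℝ) : signedPow q x * x = |x| ^ q := by
  rcases eq_or_ne x 0 with rfl | hx
  · simp [Real.zero_rpow (by linarith : q ≠ 0)]
  · have h : 0 < |x| := abs_pos.2 hx
    rw [signedPow, mul_assoc, ← sq, ← sq_abs, ← Real.rpow_natCast, ← Real.rpow_add h]
    norm_num

lemma abs_signedPow {q : ℝ} (hq : 1 < q) (x : ℝ) : |signedPow q x| = |x| ^ (q - 1) := by
  rcases eq_or_ne x 0 with rfl | hx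
  · simp [signedPow, Real.zero_rpow (by linarith : q - 1 ≠ 0)]
  · have h : 0 < |x| := abs_pos.2 hx
    rw [signedPow, abs_mul, abs_of_nonneg (Real.rpow_nonneg h.le _)]
    nth_rewrite 2 [← Real.rpow_one |x|]
    rw [← Real.rpow_add h]
    congr 1; ring

/-- The factor |x|^(q − 2) may blow up at 0 when q < 2, so continuity there comes from the modulus
|x|^(q − 1). -/
lemma continuous_signedPow {q : ℝ} (hq : 1 < q) : Continuous (signedPow q) := by
  rw [continuous_iff_continuousAt]
  intro x
  rcases eq_or_ne x 0 with rfl | hx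
  · have h0 : signedPow q 0 = 0 := by simp [signedPow]
    rw [ContinuousAt, h0, tendsto_zero_iff_abs_tendsto_zero]
    have h : Tendsto (fun x : ℝ => |x| ^ (q - 1)) (𝓝 0) (𝓝 (|0| ^ (q - 1))) :=
      ((continuous_abs.rpow_const fun _ => Or.inr (by linarith)).tendsto 0)
    rw [abs_zero, Real.zero_rpow (by linarith)] at h
    exact h.congr fun x => (abs_signedPow hq x).symm
  · unfold signedPow
    exact (continuous_abs.continuousAt.rpow_const (Or.inl (abs_ne_zero.2 hx))).mul continuousAt_id

lemma rpow_sub_one_mul {q a : ℝ} (hq : 1 < q) (ha : 0 ≤ a) : a ^ (q - 1) * a = a ^ q := by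
  rw [← Real.rpow_add_one' ha (by linarith)]; congr 1; ring

/-- A weighted Young inequality. -/
lemma rpow_sub_one_mul_le {q ε : ℝ} (hq : 1 < q) (hε : 0 < ε) {a b : ℝ} (ha : 0 ≤ a) (hb : 0 ≤ b) :
    a ^ (q - 1) * b ≤ ε * a ^ q + (1 / ε) ^ (q - 1) * b ^ q := by
  have h1 : 0 ≤ a ^ q := Real.rpow_nonneg ha _
  have h2 : 0 ≤ b ^ q := Real.rpow_nonneg hb _
  have h3 : 0 ≤ (1 / ε) ^ (q - 1) := by positivity
  -- Comparing b with ε a gives Young's inequality directly: one of the two terms on the right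
  -- already suffices in each case.
  rcases le_total b (ε * a) with h | h
  · calc a ^ (q - 1) * b ≤ a ^ (q - 1) * (ε * a) := by gcongr
      _ = ε * a ^ q := by rw [← rpow_sub_one_mul hq ha]; ring
      _ ≤ _ := le_add_of_nonneg_right (by positivity)
  · have h' : a ≤ 1 / ε * b := by
      rw [one_div, inv_mul_eq_div, le_div_iff₀ hε]; linarith
    calc a ^ (q - 1) * b ≤ (1 / ε * b) ^ (q - 1) * b := by gcongr
      _ = (1 / ε) ^ (q - 1) * b ^ q := by
        rw [Real.mul_rpow (by positivity) hb, mul_assoc, rpow_sub_one_mul hq hb]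
      _ ≤ _ := le_add_of_nonneg_left (by positivity)

/-- For small t this is differentiability of |·|^q at 1; for |t| ≥ δ each of |1 + t|^q, 1 and |t| is
at most a constant times |t|^q, because q > 1. -/
lemma abs_one_add_rpow_taylor {q ε : ℝ} (hq : 1 < q) (hε : 0 < ε) :
    ∃ C, 1 ≤ C ∧ ∀ t : ℝ, abs (|1 + t| ^ q - 1 - q * t) ≤ ε * |t| + C * |t| ^ q := by
  have hd : HasDerivAt (fun x : ℝ => |x| ^ q) q 1 := by
    simpa using hasDerivAt_abs_rpow 1 hq
  rw [hasDerivAt_iff_isLittleO_nhds_zero] at hd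
  obtain ⟨δ, hδ, h⟩ := Metric.eventually_nhds_iff.1 (hd.def hε)
  -- The first three summands bound |1 + t|^q, 1 and q|t| for |t| ≥ δ. The final 1 secures C ≥ 1,
  -- which the homogeneous form needs at a = 0, where the remainder is exactly |b|^q.
  refine ⟨(1 / δ + 1) ^ q + (1 / δ) ^ q + q * (δ * (1 / δ) ^ q) + 1, ?_, fun t => ?_⟩
  · have : 0 ≤ (1 / δ + 1) ^ q + (1 / δ) ^ q + q * (δ * (1 / δ) ^ q) := by positivity
    linarith
  have ht0 : 0 ≤ |t| ^ q := by positivity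
  rcases lt_or_ge |t| δ with ht | ht
  · have := h (y := t) (by simpa using ht)
    simp only [abs_one, Real.one_rpow, smul_eq_mul, Real.norm_eq_abs, mul_comm t q] at this
    exact this.trans (le_add_of_nonneg_right (by positivity))
  · have h1 : 1 ≤ 1 / δ * |t| := by rw [one_div, inv_mul_eq_div, le_div_iff₀ hδ]; linarith
    have h2 : |1 + t| ^ q ≤ (1 / δ + 1) ^ q * |t| ^ q := by
      rw [← Real.mul_rpow (by positivity) (abs_nonneg t)]
      refine Real.rpow_le_rpow (abs_nonneg _) ?_ (by linarith)
      calc |1 + t| ≤ |1| + |t| := abs_add_le _ _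
        _ ≤ _ := by rw [abs_one, add_mul, one_mul]; linarith
    have h3 : 1 ≤ (1 / δ) ^ q * |t| ^ q := by
      rw [← Real.mul_rpow (by positivity) (abs_nonneg t)]
      exact Real.one_le_rpow h1 (by linarith)
    have h4 : |t| ≤ δ * (1 / δ) ^ q * |t| ^ q := by
      rw [mul_assoc, ← Real.mul_rpow (by positivity) (abs_nonneg t)]
      calc |t| = δ * (1 / δ * |t|) := by field_simp
        _ ≤ _ := by gcongr; exact Real.self_le_rpow_of_one_le h1 hq.le
    have h5 : abs (|1 + t| ^ q - 1 - q * t) ≤ |1 + t| ^ q + 1 + q * |t| := by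
      refine (abs_sub _ _).trans ?_
      rw [abs_mul, abs_of_pos (by linarith : 0 < q)]
      gcongr
      refine (abs_sub _ _).trans ?_
      rw [abs_one, abs_of_nonneg (by positivity)]
    have h6 : q * |t| ≤ q * (δ * (1 / δ) ^ q * |t| ^ q) := by gcongr
    have h7 : 0 ≤ ε * |t| := by positivity
    nlinarith

/-- First order Taylor expansion of `|·| ^ q`, homogeneous form. -/
lemma abs_add_rpow_taylor {q ε : ℝ} (hq : 1 < q) (hε : 0 < ε) :
    ∃ C, 1 ≤ C ∧ ∀ a b : ℝ, abs (|a + b| ^ q - |a| ^ q - q * signedPow q a * b) ≤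
      ε * (|a| ^ (q - 1) * |b|) + C * |b| ^ q := by
  obtain ⟨C, hC, h⟩ := abs_one_add_rpow_taylor hq hε
  refine ⟨C, hC, fun a b => ?_⟩
  rcases eq_or_ne a 0 with rfl | ha
  · have h0 : 0 ≤ |b| ^ q := by positivity
    simp only [signedPow, zero_add, abs_zero, Real.zero_rpow (by linarith : q ≠ 0),
      Real.zero_rpow (by linarith : q - 1 ≠ 0), mul_zero, zero_mul, sub_zero, abs_of_nonneg h0]
    nlinarith
  · have ha' : 0 < |a| := abs_pos.2 ha
    have e1 : |a + b| ^ q = |a| ^ q * |1 + b / a| ^ q := by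
      rw [← Real.mul_rpow ha'.le (abs_nonneg _), ← abs_mul]; congr 2; field_simp
    have e2 : signedPow q a * b = |a| ^ q * (b / a) := by
      rw [← signedPow_mul_self hq a]; field_simp
    have e3 : |a| ^ (q - 1) * |b| = |a| ^ q * |b / a| := by
      rw [← rpow_sub_one_mul hq ha'.le, abs_div]; field_simp
    have e4 : |b| ^ q = |a| ^ q * |b / a| ^ q := by
      rw [← Real.mul_rpow ha'.le (abs_nonneg _), ← abs_mul]; congr 2; field_simp
    have e5 : |a + b| ^ q - |a| ^ q - q * signedPow q a * b =
        |a| ^ q * (|1 + b / a| ^ q - 1 - q * (b / a)) := by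
      rw [mul_assoc, e2, e1]; ring
    rw [e5, e3, e4, abs_mul, abs_of_nonneg (by positivity : 0 ≤ |a| ^ q)]
    have := mul_le_mul_of_nonneg_left (h (b / a)) (by positivity : 0 ≤ |a| ^ q)
    linarith

/-- The pointwise inequality behind the Brezis–Lieb lemma. -/
lemma abs_add_rpow_sub_le {q ε : ℝ} (hq : 1 < q) (hε : 0 < ε) :
    ∃ C, ∀ a b : ℝ, abs (|a + b| ^ q - |a| ^ q - |b| ^ q) ≤ ε * |a| ^ q + C * |b| ^ q := by
  obtain ⟨C, hC, h⟩ := abs_add_rpow_taylor hq one_pos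
  -- The Taylor remainder with constant 1 and the linear term together give q + 1 copies of |a|^(q −
  -- 1)|b|, each absorbed by Young's inequality with ε/(q + 1).
  have hη : 0 < ε / (q + 1) := by positivity
  refine ⟨(q + 1) * (1 / (ε / (q + 1))) ^ (q - 1) + C + 1, fun a b => ?_⟩
  have h1 := h a b
  have h2 := rpow_sub_one_mul_le hq hη (abs_nonneg a) (abs_nonneg b)
  have h3 : |q * signedPow q a * b| = q * (|a| ^ (q - 1) * |b|) := by
    rw [abs_mul, abs_mul, abs_signedPow hq, abs_of_pos (by linarith), mul_assoc]
  have h4 : 0 ≤ |b| ^ q := by positivity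
  have h5 : |(|a + b| ^ q - |a| ^ q - |b| ^ q)| ≤
      |(|a + b| ^ q - |a| ^ q - q * signedPow q a * b)| + |q * signedPow q a * b| + |b| ^ q := by
    rw [← abs_of_nonneg h4, abs_of_nonneg h4]
    calc |(|a + b| ^ q - |a| ^ q - |b| ^ q)| =
        |(|a + b| ^ q - |a| ^ q - q * signedPow q a * b) + q * signedPow q a * b - |b| ^ q| := by
          congr 1; ring
      _ ≤ _ := (abs_sub _ _).trans (by rw [abs_of_nonneg h4]; gcongr; exact abs_add_le _ _)
  have h6 := mul_le_mul_of_nonneg_left h2 (by linarith : 0 ≤ q + 1)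
  have h7 : (q + 1) * (ε / (q + 1) * |a| ^ q + (1 / (ε / (q + 1))) ^ (q - 1) * |b| ^ q) =
      ε * |a| ^ q + (q + 1) * (1 / (ε / (q + 1))) ^ (q - 1) * |b| ^ q := by
    have : q + 1 ≠ 0 := by linarith
    rw [mul_add, ← mul_assoc, ← mul_assoc, mul_div_cancel₀ _ this]
  rw [h7] at h6
  linarith

/-! ### Brezis–Lieb and differentiability of the power of the norm on L^q. -/

section
variable {α : Type*} [MeasurableSpace α] {μ : Measure α}

/-- Functions tending to zero a.e. and dominated, up to a small multiple of a bounded sequence of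
`L^1`, by integrable functions have integrals tending to zero. -/
lemma tendsto_integral_zero_of_le_add {F A : ℕ → α → ℝ} {G : α → ℝ} {M : ℝ}
    (hFm : ∀ j, Integrable (F j) μ) (hF0 : ∀ j x, 0 ≤ F j x)
    (hlim : ∀ᵐ x ∂μ, Tendsto (fun j => F j x) atTop (𝓝 0))
    (hA : ∀ j, Integrable (A j) μ) (hA0 : ∀ j x, 0 ≤ A j x) (hAM : ∀ j, ∫ x, A j x ∂μ ≤ M)
    (hG : Integrable G μ)
    (hle : ∀ ε > 0, ∃ C, ∀ j, ∀ᵐ x ∂μ, F j x ≤ ε * A j x + C * G x) :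
    Tendsto (fun j => ∫ x, F j x ∂μ) atTop (𝓝 0) := by
  have hM : 0 ≤ M := (integral_nonneg (hA0 0)).trans (hAM 0)
  rw [Metric.tendsto_atTop]
  intro ε hε
  -- M + 1 instead of M keeps the quotient meaningful when M = 0.
  have hη : 0 < ε / (2 * (M + 1)) := by positivity
  obtain ⟨C, hC⟩ := hle _ hη
  set η := ε / (2 * (M + 1)) with hηdef
  -- The positive part of F_j − ηA_j is dominated by |C G|, so dominated convergence applies to it;
  -- the discarded ηA_j contributes at most ε/2 to the integral.
  have hW : ∀ j, Integrable (fun x => max (F j x - η * A j x) 0) μ := fun j =>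
    ((hFm j).sub ((hA j).const_mul η)).pos_part
  have hWlim : Tendsto (fun j => ∫ x, max (F j x - η * A j x) 0 ∂μ) atTop (𝓝 (∫ _, (0 : ℝ) ∂μ)) := by
    refine tendsto_integral_of_dominated_convergence (fun x => |C * G x|)
      (fun j => (hW j).aestronglyMeasurable) (hG.const_mul C).abs (fun j => ?_) ?_
    · filter_upwards [hC j] with x hx
      rw [Real.norm_of_nonneg (le_max_right _ _)]
      exact max_le ((by linarith : F j x - η * A j x ≤ C * G x).trans (le_abs_self _)) (abs_nonneg _)
    · filter_upwards [hlim] with x hx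
      refine squeeze_zero (fun j => le_max_right _ _) (fun j => ?_) hx
      exact max_le (by have := mul_nonneg hη.le (hA0 j x); linarith) (hF0 j x)
  rw [integral_zero, Metric.tendsto_atTop] at hWlim
  obtain ⟨n, hn⟩ := hWlim (ε / 2) (by positivity)
  refine ⟨n, fun j hj => ?_⟩
  have h1 := hn j hj
  rw [Real.dist_0_eq_abs, abs_of_nonneg (integral_nonneg fun x => le_max_right _ _)] at h1
  rw [Real.dist_0_eq_abs, abs_of_nonneg (integral_nonneg (hF0 j))]
  have h2 : ∫ x, F j x ∂μ ≤ ∫ x, (max (F j x - η * A j x) 0 + η * A j x) ∂μ := by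
    refine integral_mono (hFm j) ((hW j).add ((hA j).const_mul η)) fun x => ?_
    have := le_max_left (F j x - η * A j x) 0
    simp only; linarith
  rw [integral_add (hW j) ((hA j).const_mul η), integral_const_mul] at h2
  have h3 : η * ∫ x, A j x ∂μ ≤ ε / 2 := by
    calc η * ∫ x, A j x ∂μ ≤ η * (M + 1) := by gcongr; linarith [hAM j]
      _ = ε / 2 := by rw [hηdef]; field_simp
  linarith

variable {q : ℝ}

lemma ofReal_ne_zero (hq : 1 < q) : ENNReal.ofReal q ≠ 0 := by
  simp only [ne_eq, ENNReal.ofReal_eq_zero, not_le]; linarith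

lemma integrable_abs_rpow (hq : 1 < q) {f : α → ℝ} (hf : MemLp f (ENNReal.ofReal q) μ) :
    Integrable (fun x => |f x| ^ q) μ := by
  simpa [ENNReal.toReal_ofReal (by linarith : 0 ≤ q)] using
    hf.integrable_norm_rpow (ofReal_ne_zero hq) ENNReal.ofReal_ne_top

lemma norm_rpow_eq_integral (hq : 1 < q) (f : Lp ℝ (ENNReal.ofReal q) μ) :
    ‖f‖ ^ q = ∫ x, |f x| ^ q ∂μ := by
  rw [Lp.norm_def, toReal_eLpNorm (Lp.aestronglyMeasurable f),
    lpNorm_eq_integral_norm_rpow_toReal (ofReal_ne_zero hq) ENNReal.ofReal_ne_top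
      (Lp.aestronglyMeasurable f), ENNReal.toReal_ofReal (by linarith), ← Real.rpow_mul,
      inv_mul_cancel₀ (by linarith), Real.rpow_one]
  · rfl
  · exact integral_nonneg fun x => by positivity

lemma integral_rpow_sub_one_mul_le [Fact (1 ≤ ENNReal.ofReal q)] (hq : 1 < q) (f h : Lp ℝ (ENNReal.ofReal q) μ) :
    ∫ x, |f x| ^ (q - 1) * |h x| ∂μ ≤ ‖f‖ ^ (q - 1) * ‖h‖ := by
  have hc : (q / (q - 1)).HolderConjugate q := by
    rw [Real.holderConjugate_iff]
    refine ⟨by rw [lt_div_iff₀] <;> linarith, ?_⟩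
    field_simp; ring
  have hf1 : MemLp (fun x => |f x| ^ (q - 1)) (ENNReal.ofReal (q / (q - 1))) μ := by
    have := (Lp.memLp f).norm_rpow_div (ENNReal.ofReal (q - 1))
    rw [ENNReal.toReal_ofReal (by linarith), ← ENNReal.ofReal_div_of_pos (by linarith)] at this
    exact this
  have H := integral_mul_le_Lp_mul_Lq_of_nonneg hc (μ := μ)
    (f := fun x => |f x| ^ (q - 1)) (g := fun x => |h x|)
    (Eventually.of_forall fun x => by positivity) (Eventually.of_forall fun x => by positivity)
    hf1 (Lp.memLp h).abs
  refine H.trans_eq ?_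
  have e1 : (fun x => (|f x| ^ (q - 1)) ^ (q / (q - 1))) = fun x => |f x| ^ q := by
    ext x
    rw [← Real.rpow_mul (abs_nonneg _), mul_div_cancel₀ _ (by linarith)]
  rw [e1, ← norm_rpow_eq_integral hq, ← norm_rpow_eq_integral hq, ← Real.rpow_mul (norm_nonneg f),
    ← Real.rpow_mul (norm_nonneg h), mul_one_div_cancel (by linarith), Real.rpow_one]
  congr 2
  field_simp

lemma integrable_rpow_sub_one_mul (hq : 1 < q) {f h : α → ℝ} (hf : MemLp f (ENNReal.ofReal q) μ)
    (hh : MemLp h (ENNReal.ofReal q) μ) : Integrable (fun x => |f x| ^ (q - 1) * |h x|) μ := by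
  refine Integrable.mono' ((integrable_abs_rpow hq hf).add (integrable_abs_rpow hq hh)) ?_ ?_
  · exact ((hf.1.aemeasurable.abs.pow_const _).mul hh.1.aemeasurable.abs).aestronglyMeasurable
  · refine Eventually.of_forall fun x => ?_
    have := rpow_sub_one_mul_le hq one_pos (abs_nonneg (f x)) (abs_nonneg (h x))
    rw [Real.norm_of_nonneg (by positivity)]
    simpa using this

lemma integrable_signedPow_mul (hq : 1 < q) {f h : α → ℝ} (hf : MemLp f (ENNReal.ofReal q) μ)
    (hh : MemLp h (ENNReal.ofReal q) μ) : Integrable (fun x => signedPow q (f x) * h x) μ := by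
  refine (integrable_rpow_sub_one_mul hq hf hh).mono' ?_ ?_
  · exact ((continuous_signedPow hq).comp_aestronglyMeasurable hf.1).mul hh.1
  · refine Eventually.of_forall fun x => ?_
    rw [norm_mul, Real.norm_eq_abs, abs_signedPow hq, Real.norm_eq_abs]

variable [Fact (1 ≤ ENNReal.ofReal q)]

/-- The functional `h ↦ q ∫ |f| ^ (q - 2) f h`, the derivative of `‖·‖ ^ q` on `L^q` at `f`. -/
noncomputable def lpPowDeriv (hq : 1 < q) (f : Lp ℝ (ENNReal.ofReal q) μ) :
    Lp ℝ (ENNReal.ofReal q) μ →L[ℝ] ℝ :=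
  LinearMap.mkContinuous
    { toFun := fun h => q * ∫ x, signedPow q (f x) * h x ∂μ
      map_add' := fun g h => by
        rw [← mul_add, ← integral_add (integrable_signedPow_mul hq (Lp.memLp f) (Lp.memLp g))
          (integrable_signedPow_mul hq (Lp.memLp f) (Lp.memLp h))]
        congr 1
        refine integral_congr_ae ?_
        filter_upwards [Lp.coeFn_add g h] with x hx
        rw [hx, Pi.add_apply]; ring
      map_smul' := fun c h => by
        have e : ∫ x, signedPow q (f x) * (c • h : Lp ℝ (ENNReal.ofReal q) μ) x ∂μ =
            c * ∫ x, signedPow q (f x) * h x ∂μ := by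
          rw [← integral_const_mul]
          refine integral_congr_ae ?_
          filter_upwards [Lp.coeFn_smul c h] with x hx
          rw [hx, Pi.smul_apply, smul_eq_mul]; ring
        rw [e, RingHom.id_apply, smul_eq_mul]; ring }
    (q * ‖f‖ ^ (q - 1)) (fun h => by
      simp only [LinearMap.coe_mk, AddHom.coe_mk, norm_mul, Real.norm_of_nonneg
        (by linarith : (0 : ℝ) ≤ q), mul_assoc]
      gcongr
      refine (norm_integral_le_integral_norm (μ := μ) _).trans ?_
      simpa [abs_signedPow hq] using integral_rpow_sub_one_mul_le hq f h)

lemma lpPowDeriv_apply (hq : 1 < q) (f h : Lp ℝ (ENNReal.ofReal q) μ) :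
    lpPowDeriv hq f h = q * ∫ x, signedPow q (f x) * h x ∂μ := rfl

lemma lpPowDeriv_self (hq : 1 < q) (f : Lp ℝ (ENNReal.ofReal q) μ) :
    lpPowDeriv hq f f = q * ‖f‖ ^ q := by
  simp only [lpPowDeriv_apply, signedPow_mul_self hq, norm_rpow_eq_integral hq]

/-- The pointwise Taylor estimate is integrated. Hölder turns its first term into a small multiple
of ‖f‖^(q − 1)‖h‖, and the second is C‖h‖^q = o(‖h‖) because q > 1. -/
lemma hasFDerivAt_norm_rpow_Lp (hq : 1 < q) (f : Lp ℝ (ENNReal.ofReal q) μ) :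
    HasFDerivAt (fun g : Lp ℝ (ENNReal.ofReal q) μ => ‖g‖ ^ q) (lpPowDeriv hq f) f := by
  rw [hasFDerivAt_iff_isLittleO_nhds_zero, Asymptotics.isLittleO_iff]
  intro ε hε
  have hη : 0 < ε / (2 * (‖f‖ ^ (q - 1) + 1)) := by positivity
  obtain ⟨C, hC, hCle⟩ := abs_add_rpow_taylor hq hη
  have hsmall : ∀ᶠ h : Lp ℝ (ENNReal.ofReal q) μ in 𝓝 0, C * ‖h‖ ^ (q - 1) < ε / 2 := by
    have : Tendsto (fun h : Lp ℝ (ENNReal.ofReal q) μ => C * ‖h‖ ^ (q - 1)) (𝓝 0)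
        (𝓝 (C * ‖(0 : Lp ℝ (ENNReal.ofReal q) μ)‖ ^ (q - 1))) :=
      (continuous_const.mul (continuous_norm.rpow_const fun _ => Or.inr (by linarith))).tendsto 0
    rw [norm_zero, Real.zero_rpow (by linarith), mul_zero] at this
    exact this.eventually (gt_mem_nhds (by positivity))
  filter_upwards [hsmall] with h hh
  have hI1 := integrable_rpow_sub_one_mul hq (Lp.memLp f) (Lp.memLp h)
  have hI2 := integrable_abs_rpow hq (Lp.memLp h)
  have hIf := integrable_abs_rpow hq (Lp.memLp f)
  have hIs := (integrable_signedPow_mul hq (Lp.memLp f) (Lp.memLp h)).const_mul q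
  have hIa : Integrable (fun x => |f x + h x| ^ q) μ :=
    integrable_abs_rpow hq ((Lp.memLp f).add (Lp.memLp h))
  have e : ‖f + h‖ ^ q - ‖f‖ ^ q - lpPowDeriv hq f h =
      ∫ x, (|f x + h x| ^ q - |f x| ^ q - q * (signedPow q (f x) * h x)) ∂μ := by
    have hI : Integrable (fun x => |f x + h x| ^ q - |f x| ^ q) μ := hIa.sub hIf
    rw [integral_sub hI hIs, integral_sub hIa hIf, integral_const_mul,
      norm_rpow_eq_integral hq, norm_rpow_eq_integral hq, lpPowDeriv_apply]
    congr 2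
    refine integral_congr_ae ?_
    filter_upwards [Lp.coeFn_add f h] with x hx
    rw [hx, Pi.add_apply]
  rw [e]
  calc ‖∫ x, (|f x + h x| ^ q - |f x| ^ q - q * (signedPow q (f x) * h x)) ∂μ‖
      ≤ ∫ x, (ε / (2 * (‖f‖ ^ (q - 1) + 1)) * (|f x| ^ (q - 1) * |h x|) + C * |h x| ^ q) ∂μ := by
        refine norm_integral_le_of_norm_le ((hI1.const_mul _).add (hI2.const_mul _)) ?_
        refine Eventually.of_forall fun x => ?_
        rw [Real.norm_eq_abs, ← mul_assoc q]
        exact hCle _ _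
    _ = ε / (2 * (‖f‖ ^ (q - 1) + 1)) * (∫ x, |f x| ^ (q - 1) * |h x| ∂μ)
          + C * ∫ x, |h x| ^ q ∂μ := by
        rw [integral_add (hI1.const_mul _) (hI2.const_mul _), integral_const_mul,
          integral_const_mul]
    _ ≤ ε / (2 * (‖f‖ ^ (q - 1) + 1)) * (‖f‖ ^ (q - 1) * ‖h‖) + C * (‖h‖ ^ (q - 1) * ‖h‖) := by
        rw [← norm_rpow_eq_integral hq, rpow_sub_one_mul hq (norm_nonneg _)]
        gcongr
        exact integral_rpow_sub_one_mul_le hq f h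
    _ ≤ ε / 2 * ‖h‖ + ε / 2 * ‖h‖ := by
        have h0 : 0 ≤ ‖f‖ ^ (q - 1) := by positivity
        have h1 : ε / (2 * (‖f‖ ^ (q - 1) + 1)) * ‖f‖ ^ (q - 1) ≤ ε / 2 := by
          rw [div_mul_eq_mul_div, div_le_div_iff₀ (by positivity) (by positivity)]
          nlinarith
        rw [← mul_assoc, ← mul_assoc]
        gcongr
    _ = ε * ‖h‖ := by ring

/-- The Brezis–Lieb lemma. -/
lemma tendsto_norm_rpow_sub (hq : 1 < q) {f : ℕ → Lp ℝ (ENNReal.ofReal q) μ}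
    {g : Lp ℝ (ENNReal.ofReal q) μ} {R : ℝ} (hR : ∀ j, ‖f j‖ ≤ R)
    (hlim : ∀ᵐ x ∂μ, Tendsto (fun j => f j x) atTop (𝓝 (g x))) :
    Tendsto (fun j => ‖f j‖ ^ q - ‖f j - g‖ ^ q) atTop (𝓝 (‖g‖ ^ q)) := by
  have hIf := fun j => integrable_abs_rpow hq (Lp.memLp (f j))
  have hIg := integrable_abs_rpow hq (Lp.memLp g)
  have hIs : ∀ j, Integrable (fun x => |f j x - g x| ^ q) μ := fun j =>
    integrable_abs_rpow hq ((Lp.memLp (f j)).sub (Lp.memLp g))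
  have hn : ∀ j, ‖f j - g‖ ^ q = ∫ x, |f j x - g x| ^ q ∂μ := fun j => by
    rw [norm_rpow_eq_integral hq]
    refine integral_congr_ae ?_
    filter_upwards [Lp.coeFn_sub (f j) g] with x hx
    rw [hx, Pi.sub_apply]
  have key : Tendsto (fun j => ∫ x, abs (|f j x| ^ q - |f j x - g x| ^ q - |g x| ^ q) ∂μ)
      atTop (𝓝 0) := by
    -- The pointwise inequality is used with a = f_j − g, bounded in L^q, and b = g, which is fixed.
    refine tendsto_integral_zero_of_le_add (A := fun j x => |f j x - g x| ^ q)
      (G := fun x => |g x| ^ q) (M := (R + ‖g‖) ^ q)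
      (fun j => (((hIf j).sub (hIs j)).sub hIg).abs) (fun j x => abs_nonneg _) ?_ hIs
      (fun j x => by positivity) (fun j => ?_) hIg (fun ε hε => ?_)
    · filter_upwards [hlim] with x hx
      have h1 : Tendsto (fun j => |f j x| ^ q) atTop (𝓝 (|g x| ^ q)) :=
        hx.abs.rpow_const (Or.inr (by linarith))
      have h2 : Tendsto (fun j => |f j x - g x| ^ q) atTop (𝓝 (|g x - g x| ^ q)) :=
        (hx.sub_const _).abs.rpow_const (Or.inr (by linarith))
      have h3 := ((h1.sub h2).sub_const (|g x| ^ q)).abs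
      simpa [Real.zero_rpow (by linarith : q ≠ 0)] using h3
    · rw [← hn j]
      gcongr
      exact (norm_sub_le _ _).trans (by gcongr; exact hR j)
    · obtain ⟨C, hC⟩ := abs_add_rpow_sub_le hq hε
      refine ⟨C, fun j => Eventually.of_forall fun x => ?_⟩
      simpa using hC (f j x - g x) (g x)
  rw [← tendsto_sub_nhds_zero_iff]
  refine squeeze_zero_norm (fun j => ?_) key
  have hI : Integrable (fun x => |f j x| ^ q - |f j x - g x| ^ q) μ := (hIf j).sub (hIs j)
  rw [norm_rpow_eq_integral hq (f j), norm_rpow_eq_integral hq g, hn, ← integral_sub (hIf j) (hIs j),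
    ← integral_sub hI hIg]
  exact norm_integral_le_integral_norm _

/-- This replaces weak convergence of the derivatives: tested against the limit g itself, |f_j|^(q −
1)|g| splits by Young into a small multiple of |f_j|^q and a multiple of the fixed function |g|^q.
-/
lemma tendsto_lpPowDeriv_limit (hq : 1 < q) {f : ℕ → Lp ℝ (ENNReal.ofReal q) μ}
    {g : Lp ℝ (ENNReal.ofReal q) μ} {R : ℝ} (hR : ∀ j, ‖f j‖ ≤ R)
    (hlim : ∀ᵐ x ∂μ, Tendsto (fun j => f j x) atTop (𝓝 (g x))) :
    Tendsto (fun j => lpPowDeriv hq (f j) g) atTop (𝓝 (q * ‖g‖ ^ q)) := by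
  have hIf := fun j => integrable_abs_rpow hq (Lp.memLp (f j))
  have hIg := integrable_abs_rpow hq (Lp.memLp g)
  have hIs := fun j => integrable_signedPow_mul hq (Lp.memLp (f j)) (Lp.memLp g)
  have key : Tendsto (fun j => ∫ x, abs (signedPow q (f j x) * g x - |g x| ^ q) ∂μ)
      atTop (𝓝 0) := by
    refine tendsto_integral_zero_of_le_add (A := fun j x => |f j x| ^ q)
      (G := fun x => |g x| ^ q) (M := R ^ q)
      (fun j => ((hIs j).sub hIg).abs) (fun j x => abs_nonneg _) ?_ hIf
      (fun j x => by positivity) (fun j => ?_) hIg (fun ε hε => ?_)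
    · filter_upwards [hlim] with x hx
      have h1 := ((((continuous_signedPow hq).tendsto _).comp hx).mul_const (g x)).sub_const
        (|g x| ^ q)
      rw [signedPow_mul_self hq, sub_self] at h1
      simpa using h1.abs
    · rw [← norm_rpow_eq_integral hq]
      gcongr
      exact hR j
    · refine ⟨(1 / ε) ^ (q - 1) + 1, fun j => Eventually.of_forall fun x => ?_⟩
      refine (abs_sub _ _).trans ?_
      rw [abs_mul, abs_signedPow hq, abs_of_nonneg (by positivity : 0 ≤ |g x| ^ q)]
      have := rpow_sub_one_mul_le hq hε (abs_nonneg (f j x)) (abs_nonneg (g x))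
      linarith
  have : Tendsto (fun j => ∫ x, signedPow q (f j x) * g x ∂μ) atTop (𝓝 (‖g‖ ^ q)) := by
    rw [← tendsto_sub_nhds_zero_iff]
    refine squeeze_zero_norm (fun j => ?_) key
    rw [norm_rpow_eq_integral hq, ← integral_sub (hIs j) hIg]
    exact norm_integral_le_integral_norm _
  exact this.const_mul q

end

/-! ### The Palais–Smale condition for an abstract functional. -/

/-- Dividing by b^(p/q) when b > 0 gives b ≥ S^(q/(q − p)): a concentrating remainder must carry at
least the threshold mass. -/
lemma eq_zero_of_mul_rpow_le {p q S b : ℝ} (hp : 1 < p) (hpq : p < q) (hS : 0 ≤ S) (hb : 0 ≤ b)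
    (h : S * b ^ (p / q) ≤ b) (hlt : b < S ^ (q / (q - p))) : b = 0 := by
  by_contra hne
  have hb' : 0 < b := lt_of_le_of_ne hb (Ne.symm hne)
  have h0 : 0 < b ^ (p / q) := by positivity
  have h1 : S ≤ b ^ (1 - p / q) := by
    rw [Real.rpow_sub hb', Real.rpow_one, le_div_iff₀ h0]
    exact h
  have h2 : S ^ (q / (q - p)) ≤ (b ^ (1 - p / q)) ^ (q / (q - p)) :=
    Real.rpow_le_rpow hS h1 (div_nonneg (by linarith) (by linarith))
  have h3 : (1 - p / q) * (q / (q - p)) = 1 := by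
    have : q - p ≠ 0 := by linarith
    have : q ≠ 0 := by linarith
    field_simp
  rw [← Real.rpow_mul hb, h3, Real.rpow_one] at h2
  linarith

/-- For t ≥ 1 the right side is at most (A + B)t, and division by t leaves t^(p − 1). This gives the
boundedness of Palais–Smale sequences. -/
lemma le_of_rpow_le_add_mul {p A B t : ℝ} (hp : 1 < p) (hA : 0 ≤ A) (ht : 0 ≤ t)
    (h : t ^ p ≤ A + B * t) : t ≤ max 1 ((A + B) ^ (1 / (p - 1))) := by
  rcases le_total t 1 with h1 | h1
  · exact h1.trans (le_max_left _ _)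
  · refine le_max_of_le_right ?_
    have h2 : t ^ (p - 1) ≤ A + B := by
      have : t ^ (p - 1) * t ≤ (A + B) * t := by
        rw [rpow_sub_one_mul hp ht]; nlinarith
      exact le_of_mul_le_mul_right this (by linarith)
    calc t = (t ^ (p - 1)) ^ (1 / (p - 1)) := by
          rw [← Real.rpow_mul ht, mul_one_div_cancel (by linarith), Real.rpow_one]
      _ ≤ _ := Real.rpow_le_rpow (by positivity) h2 (div_nonneg zero_le_one (by linarith))

section
variable {α β : Type*} [MeasurableSpace α] [MeasurableSpace β] {μ : Measure α} {ν : Measure β}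
  {W : Type*} [NormedAddCommGroup W] [NormedSpace ℝ W] {p q : ℝ}
  [Fact (1 ≤ ENNReal.ofReal p)] [Fact (1 ≤ ENNReal.ofReal q)]

/-- The derivative at `u` of
`‖T₁ u‖ ^ p / p - lam / p * ‖T₂ u‖ ^ p - ‖T₃ u‖ ^ q / q`. -/
noncomputable def energyDeriv (hp : 1 < p) (hq : 1 < q) (T₁ : W →L[ℝ] Lp ℝ (ENNReal.ofReal p) μ)
    (T₂ : W →L[ℝ] Lp ℝ (ENNReal.ofReal p) ν) (T₃ : W →L[ℝ] Lp ℝ (ENNReal.ofReal q) ν) (lam : ℝ)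
    (u : W) : W →L[ℝ] ℝ :=
  (1 / p) • (lpPowDeriv hp (T₁ u)).comp T₁ - (lam / p) • (lpPowDeriv hp (T₂ u)).comp T₂
    - (1 / q) • (lpPowDeriv hq (T₃ u)).comp T₃

variable (hp : 1 < p) (hq : 1 < q) (T₁ : W →L[ℝ] Lp ℝ (ENNReal.ofReal p) μ)
    (T₂ : W →L[ℝ] Lp ℝ (ENNReal.ofReal p) ν) (T₃ : W →L[ℝ] Lp ℝ (ENNReal.ofReal q) ν) (lam : ℝ)

lemma energyDeriv_apply (u v : W) : energyDeriv hp hq T₁ T₂ T₃ lam u v =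
    1 / p * lpPowDeriv hp (T₁ u) (T₁ v) - lam / p * lpPowDeriv hp (T₂ u) (T₂ v)
      - 1 / q * lpPowDeriv hq (T₃ u) (T₃ v) := by
  simp only [energyDeriv, sub_apply, smul_apply,
    ContinuousLinearMap.comp_apply, smul_eq_mul]

lemma energyDeriv_self (u : W) : energyDeriv hp hq T₁ T₂ T₃ lam u u =
    ‖T₁ u‖ ^ p - lam * ‖T₂ u‖ ^ p - ‖T₃ u‖ ^ q := by
  rw [energyDeriv_apply, lpPowDeriv_self, lpPowDeriv_self, lpPowDeriv_self]
  have : p ≠ 0 := by linarith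
  have : q ≠ 0 := by linarith
  field_simp

lemma hasFDerivAt_energy (u : W) :
    HasFDerivAt (fun u => 1 / p * ‖T₁ u‖ ^ p - lam / p * ‖T₂ u‖ ^ p - 1 / q * ‖T₃ u‖ ^ q)
      (energyDeriv hp hq T₁ T₂ T₃ lam u) u := by
  have h₁ := (hasFDerivAt_norm_rpow_Lp hp (T₁ u)).comp u T₁.hasFDerivAt
  have h₂ := (hasFDerivAt_norm_rpow_Lp hp (T₂ u)).comp u T₂.hasFDerivAt
  have h₃ := (hasFDerivAt_norm_rpow_Lp hq (T₃ u)).comp u T₃.hasFDerivAt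
  exact ((h₁.const_mul (1 / p)).sub (h₂.const_mul (lam / p))).sub (h₃.const_mul (1 / q))

/-- The limiting step: a bounded Palais–Smale sequence below the threshold that converges almost
everywhere converges in norm. -/
lemma tendsto_of_palaisSmale {p q : ℝ} [Fact (1 ≤ ENNReal.ofReal p)] [Fact (1 ≤ ENNReal.ofReal q)]
    (hp : 1 < p) (hpq : p < q) (hq : 1 < q) {T₁ : W →L[ℝ] Lp ℝ (ENNReal.ofReal p) μ}
    {T₂ : W →L[ℝ] Lp ℝ (ENNReal.ofReal p) ν} {T₃ : W →L[ℝ] Lp ℝ (ENNReal.ofReal q) ν} {lam : ℝ}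
    (hT₁ : ∀ u, ‖T₁ u‖ = ‖u‖) {S c : ℝ} (hS : 0 ≤ S) (hST : ∀ u, S * ‖T₃ u‖ ^ p ≤ ‖u‖ ^ p)
    (hc : c < (1 / p - 1 / q) * S ^ (q / (q - p))) {v : ℕ → W} {w : W} {R : ℝ}
    (hR : ∀ j, ‖v j‖ ≤ R)
    (hΦ : Tendsto (fun j => 1 / p * ‖T₁ (v j)‖ ^ p - lam / p * ‖T₂ (v j)‖ ^ p
      - 1 / q * ‖T₃ (v j)‖ ^ q) atTop (𝓝 c))
    (hΦ' : Tendsto (fun j => energyDeriv hp hq T₁ T₂ T₃ lam (v j)) atTop (𝓝 0))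
    (h₁ : ∀ᵐ x ∂μ, Tendsto (fun j => T₁ (v j) x) atTop (𝓝 (T₁ w x)))
    (h₂ : Tendsto (fun j => T₂ (v j)) atTop (𝓝 (T₂ w)))
    (h₂' : ∀ᵐ x ∂ν, Tendsto (fun j => T₂ (v j) x) atTop (𝓝 (T₂ w x)))
    (h₃ : ∀ᵐ x ∂ν, Tendsto (fun j => T₃ (v j) x) atTop (𝓝 (T₃ w x))) :
    Tendsto v atTop (𝓝 w) := by
  have hp0 : 0 < p := by linarith
  have hq0 : 0 < q := by linarith
  set κ := 1 / p - 1 / q with hκdef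
  have hκ : 0 < κ := sub_pos.2 (one_div_lt_one_div_of_lt hp0 hpq)
  have hR1 : ∀ j, ‖T₁ (v j)‖ ≤ R := fun j => (hT₁ _).trans_le (hR j)
  have hR2 : ∀ j, ‖T₂ (v j)‖ ≤ ‖T₂‖ * R := fun j => T₂.le_opNorm_of_le (hR j)
  have hR3 : ∀ j, ‖T₃ (v j)‖ ≤ ‖T₃‖ * R := fun j => T₃.le_opNorm_of_le (hR j)
  have hself : Tendsto (fun j => energyDeriv hp hq T₁ T₂ T₃ lam (v j) (v j)) atTop (𝓝 0) := by
    have hn : Tendsto (fun j => ‖energyDeriv hp hq T₁ T₂ T₃ lam (v j)‖ * R) atTop (𝓝 0) := by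
      simpa using hΦ'.norm.mul_const R
    exact squeeze_zero_norm (fun j => ContinuousLinearMap.le_opNorm_of_le _ (hR j)) hn
  -- Only the direction w is tested; that w is a critical point in every direction plays no role.
  have hw : energyDeriv hp hq T₁ T₂ T₃ lam w w = 0 := by
    have e1 : Tendsto (fun j => energyDeriv hp hq T₁ T₂ T₃ lam (v j) w) atTop (𝓝 0) := by
      have hn : Tendsto (fun j => ‖energyDeriv hp hq T₁ T₂ T₃ lam (v j)‖ * ‖w‖) atTop (𝓝 0) := by
        simpa using hΦ'.norm.mul_const ‖w‖
      exact squeeze_zero_norm (fun j => ContinuousLinearMap.le_opNorm _ w) hn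
    have e2 : Tendsto (fun j => energyDeriv hp hq T₁ T₂ T₃ lam (v j) w) atTop
        (𝓝 (energyDeriv hp hq T₁ T₂ T₃ lam w w)) := by
      simp only [energyDeriv_apply, lpPowDeriv_self]
      exact (((tendsto_lpPowDeriv_limit hp hR1 h₁).const_mul _).sub
        ((tendsto_lpPowDeriv_limit hp hR2 h₂').const_mul _)).sub
        ((tendsto_lpPowDeriv_limit hq hR3 h₃).const_mul _)
    exact tendsto_nhds_unique e2 e1
  rw [energyDeriv_self] at hw
  -- Φ(v) − Φ'(v)v/p = κ‖T₃ v‖^q, so the critical norms converge even before strong convergence is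
  -- known.
  have hb3 : Tendsto (fun j => ‖T₃ (v j)‖ ^ q) atTop (𝓝 (c / κ)) := by
    have h := ((hΦ.sub (hself.const_mul (1 / p))).div_const κ)
    rw [mul_zero, sub_zero] at h
    refine h.congr fun j => ?_
    rw [energyDeriv_self, div_eq_iff hκ.ne', hκdef]
    field_simp
    ring
  have hT2 : Tendsto (fun j => ‖T₂ (v j)‖ ^ p) atTop (𝓝 (‖T₂ w‖ ^ p)) :=
    h₂.norm.rpow_const (Or.inr hp0.le)
  have hBL1 := tendsto_norm_rpow_sub hp hR1 h₁
  have hBL3 := tendsto_norm_rpow_sub hq hR3 h₃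
  set b := c / κ - ‖T₃ w‖ ^ q with hb
  have hbj : Tendsto (fun j => ‖T₃ (v j - w)‖ ^ q) atTop (𝓝 b) := by
    refine (hb3.sub hBL3).congr fun j => ?_
    rw [map_sub]; ring
  -- Brezis–Lieb for T₁, the limit of Φ'(v_j)v_j and the relation Φ'(w)w = 0 combine to the same
  -- limit b as for the critical norm.
  have haj : Tendsto (fun j => ‖v j - w‖ ^ p) atTop (𝓝 b) := by
    have h := ((hself.add (hT2.const_mul lam)).add hb3).sub hBL1
    have e : 0 + lam * ‖T₂ w‖ ^ p + c / κ - ‖T₁ w‖ ^ p = b := by rw [hb]; linarith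
    rw [e] at h
    refine h.congr fun j => ?_
    rw [energyDeriv_self, ← hT₁, map_sub]; ring
  have hb0 : 0 ≤ b := ge_of_tendsto' hbj fun j => by positivity
  have hSb : S * b ^ (p / q) ≤ b := by
    refine le_of_tendsto_of_tendsto' ((hbj.rpow_const (p := p / q)
      (Or.inr (by positivity))).const_mul S) haj fun j => ?_
    rw [← Real.rpow_mul (norm_nonneg _), mul_div_cancel₀ _ hq0.ne']
    exact hST _
  have hlt : b < S ^ (q / (q - p)) := by
    have h1 : c / κ < S ^ (q / (q - p)) := by rwa [div_lt_iff₀' hκ]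
    have h2 : 0 ≤ ‖T₃ w‖ ^ q := by positivity
    linarith
  have hbz := eq_zero_of_mul_rpow_le hp hpq hS hb0 hSb hlt
  rw [hbz] at haj
  rw [tendsto_iff_norm_sub_tendsto_zero]
  have h := haj.rpow_const (p := 1 / p) (Or.inr (by positivity))
  rw [Real.zero_rpow (by positivity)] at h
  refine h.congr fun j => ?_
  rw [← Real.rpow_mul (norm_nonneg _), mul_one_div_cancel hp0.ne', Real.rpow_one]

/-- An abstract Palais–Smale condition for Brezis–Nirenberg type functionals. -/
theorem satisfiesPS_of_compact {p q : ℝ} [Fact (1 ≤ ENNReal.ofReal p)]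
    [Fact (1 ≤ ENNReal.ofReal q)] (hp : 1 < p) (hpq : p < q)
    (T₁ : W →L[ℝ] Lp ℝ (ENNReal.ofReal p) μ) (T₂ : W →L[ℝ] Lp ℝ (ENNReal.ofReal p) ν)
    (T₃ : W →L[ℝ] Lp ℝ (ENNReal.ofReal q) ν) (lam : ℝ)
    (hT₁ : ∀ u, ‖T₁ u‖ = ‖u‖) {S c K : ℝ} (hS : 0 ≤ S) (hST : ∀ u, S * ‖T₃ u‖ ^ p ≤ ‖u‖ ^ p)
    (hK : 0 ≤ K) (hT₂₃ : ∀ u, ‖T₂ u‖ ≤ K * ‖T₃ u‖)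
    (hcpt : ∀ (u : ℕ → W) (R : ℝ), (∀ j, ‖u j‖ ≤ R) → ∃ (w : W) (φ : ℕ → ℕ), StrictMono φ ∧
      (∀ᵐ x ∂μ, Tendsto (fun j => T₁ (u (φ j)) x) atTop (𝓝 (T₁ w x))) ∧
      Tendsto (fun j => T₂ (u (φ j))) atTop (𝓝 (T₂ w)) ∧
      (∀ᵐ x ∂ν, Tendsto (fun j => T₂ (u (φ j)) x) atTop (𝓝 (T₂ w x))) ∧
      (∀ᵐ x ∂ν, Tendsto (fun j => T₃ (u (φ j)) x) atTop (𝓝 (T₃ w x))))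
    (hc : c < (1 / p - 1 / q) * S ^ (q / (q - p))) :
    SatisfiesPS (fun u => 1 / p * ‖u‖ ^ p - lam / p * ‖T₂ u‖ ^ p - 1 / q * ‖T₃ u‖ ^ q) c := by
  intro u hΦ hΦ'
  have hp0 : 0 < p := by linarith
  have hq : 1 < q := by linarith
  have hq0 : 0 < q := by linarith
  -- Rewriting ‖u‖ as an L^p norm makes the functional differentiable everywhere, so `fderiv` is the
  -- true derivative and not its default value 0.
  simp only [← hT₁] at hΦ hΦ'
  simp only [(hasFDerivAt_energy hp hq T₁ T₂ T₃ lam _).fderiv] at hΦ'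
  set κ := 1 / p - 1 / q with hκdef
  have hκ : 0 < κ := sub_pos.2 (one_div_lt_one_div_of_lt hp0 hpq)
  obtain ⟨R, hR⟩ : ∃ R, ∀ᶠ j in atTop, ‖u j‖ ≤ R := by
    set L := |lam| * K ^ p with hL
    have hL0 : 0 ≤ L := by positivity
    -- From Φ'(u)u one gets ‖u‖^p ≤ ‖u‖ + L(1 + ‖T₃u‖^q) + ‖T₃u‖^q; inserting ‖T₃u‖^q ≤ (|c| + 1)/κ
    -- + ‖u‖/(pκ) yields A + B‖u‖.
    set A := L + (L + 1) * ((|c| + 1) / κ)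
    set B := 1 + (L + 1) * (1 / p / κ)
    refine ⟨max 1 ((A + B) ^ (1 / (p - 1))), ?_⟩
    have e1 : ∀ᶠ j in atTop, 1 / p * ‖T₁ (u j)‖ ^ p - lam / p * ‖T₂ (u j)‖ ^ p
        - 1 / q * ‖T₃ (u j)‖ ^ q < |c| + 1 :=
      hΦ.eventually (gt_mem_nhds (by linarith [le_abs_self c]))
    have e2 : ∀ᶠ j in atTop, ‖energyDeriv hp hq T₁ T₂ T₃ lam (u j)‖ < 1 :=
      hΦ'.norm.eventually (gt_mem_nhds (by simp))
    filter_upwards [e1, e2] with j h1 h2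
    refine le_of_rpow_le_add_mul hp (by positivity) (norm_nonneg _) ?_
    have h3 : |energyDeriv hp hq T₁ T₂ T₃ lam (u j) (u j)| ≤ ‖u j‖ := by
      have := (energyDeriv hp hq T₁ T₂ T₃ lam (u j)).le_opNorm (u j)
      rw [Real.norm_eq_abs] at this
      nlinarith [norm_nonneg (u j)]
    rw [energyDeriv_self] at h3
    obtain ⟨h3, h4⟩ := abs_le.1 h3
    have h5 : ‖T₃ (u j)‖ ^ q ≤ (|c| + 1) / κ + 1 / p / κ * ‖u j‖ := by
      have : ‖T₃ (u j)‖ ^ q * κ ≤ |c| + 1 + 1 / p * ‖u j‖ := by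
        have h6 := mul_le_mul_of_nonneg_left h3 (by positivity : 0 ≤ 1 / p)
        have h7 : ‖T₃ (u j)‖ ^ q * κ = 1 / p * ‖T₁ (u j)‖ ^ p - lam / p * ‖T₂ (u j)‖ ^ p
            - 1 / q * ‖T₃ (u j)‖ ^ q
            - 1 / p * (‖T₁ (u j)‖ ^ p - lam * ‖T₂ (u j)‖ ^ p - ‖T₃ (u j)‖ ^ q) := by
          rw [hκdef]; ring
        linarith
      rw [← le_div_iff₀ hκ] at this
      refine this.trans_eq ?_
      ring
    have h6 : lam * ‖T₂ (u j)‖ ^ p ≤ L * (1 + ‖T₃ (u j)‖ ^ q) := by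
      have h7 : ‖T₂ (u j)‖ ^ p ≤ K ^ p * ‖T₃ (u j)‖ ^ p := by
        rw [← Real.mul_rpow hK (norm_nonneg _)]
        exact Real.rpow_le_rpow (norm_nonneg _) (hT₂₃ _) hp0.le
      have h8 : ‖T₃ (u j)‖ ^ p ≤ 1 + ‖T₃ (u j)‖ ^ q := by
        rcases le_total ‖T₃ (u j)‖ 1 with h | h
        · have := Real.rpow_le_one (norm_nonneg _) h hp0.le
          have : 0 ≤ ‖T₃ (u j)‖ ^ q := by positivity
          linarith
        · have := Real.rpow_le_rpow_of_exponent_le h hpq.le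
          linarith
      calc lam * ‖T₂ (u j)‖ ^ p ≤ |lam| * (K ^ p * ‖T₃ (u j)‖ ^ p) := by
            refine mul_le_mul (le_abs_self _) h7 (by positivity) (abs_nonneg _)
        _ ≤ |lam| * (K ^ p * (1 + ‖T₃ (u j)‖ ^ q)) := by gcongr
        _ = _ := by rw [hL]; ring
    rw [hT₁] at h4
    have h7 := mul_le_mul_of_nonneg_left h5 (by linarith : 0 ≤ L + 1)
    have h8 : A + B * ‖u j‖ =
        ‖u j‖ + L + (L + 1) * ((|c| + 1) / κ + 1 / p / κ * ‖u j‖) := by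
      simp only [A, B]; ring
    rw [h8]
    linarith
  -- The bound holds only eventually, so compactness is applied to the sequence shifted by n.
  obtain ⟨n, hn⟩ := eventually_atTop.1 hR
  obtain ⟨w, φ, hφ, h₁, h₂, h₂', h₃⟩ := hcpt (fun j => u (j + n)) R
    (fun j => hn _ (Nat.le_add_left _ _))
  have hφn : StrictMono fun j => φ j + n := fun i j hij => Nat.add_lt_add_right (hφ hij) n
  exact ⟨w, fun j => φ j + n, hφn, tendsto_of_palaisSmale hp hpq hq hT₁ hS hST hc
    (fun j => hn _ (Nat.le_add_left _ _)) (hΦ.comp hφn.tendsto_atTop)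
    (hΦ'.comp hφn.tendsto_atTop) h₁ h₂ h₂' h₃⟩

end

/-! ### The fractional Sobolev inequality. -/

section
variable {N : ℕ} {s p : ℝ}

lemma volume_ball_eq_ofReal (x : EuclideanSpace ℝ (Fin N)) {r : ℝ} (hr : 0 < r) :
    volume (Metric.ball x r) =
      ENNReal.ofReal ((volume (Metric.ball (0 : EuclideanSpace ℝ (Fin N)) 1)).toReal * r ^ N) := by
  rw [Measure.addHaar_ball_of_pos volume x hr, finrank_euclideanSpace_fin, mul_comm,
    ENNReal.ofReal_mul ENNReal.toReal_nonneg, ENNReal.ofReal_toReal measure_ball_lt_top.ne]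

/-- On at least half of a ball around `x` with `2 (2 / |u x|) ^ q ∫ |u| ^ q` as its volume, `u`
differs from `u x` by at least `|u x| / 2`. -/
lemma lintegral_diffQuot_ge {q a r : ℝ} (hs : 0 < s) (hp : 0 < p) (ha : 0 < a)
    {u : EuclideanSpace ℝ (Fin N) → ℝ} (hu : Measurable u)
    (hA : ∫⁻ y, ENNReal.ofReal (|u y| ^ q) ≤ ENNReal.ofReal a) (hq : 0 < q)
    {x : EuclideanSpace ℝ (Fin N)} (hx : u x ≠ 0) (hr : 0 < r)
    (hvol : (volume (Metric.ball (0 : EuclideanSpace ℝ (Fin N)) 1)).toReal * r ^ N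
      = 2 * (a / (|u x| / 2) ^ q)) :
    ENNReal.ofReal ((|u x| / 2) ^ p / r ^ ((N : ℝ) + s * p) * (a / (|u x| / 2) ^ q)) ≤
      ∫⁻ y, ENNReal.ofReal (|u x - u y| ^ p / ‖x - y‖ ^ ((N : ℝ) + s * p)) := by
  set t := |u x| with ht
  have ht0 : 0 < t := abs_pos.2 hx
  set m := a / (t / 2) ^ q with hm
  have hm0 : 0 < m := by positivity
  set bad : Set (EuclideanSpace ℝ (Fin N)) := {y | t / 2 ≤ |u y|} with hbad
  have hbadm : MeasurableSet bad := measurableSet_le measurable_const hu.abs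
  -- By Chebyshev the bad set has measure at most m, half the volume 2m of the ball.
  have hbadv : volume bad ≤ ENNReal.ofReal m := by
    have h1 : bad ⊆ {y | ENNReal.ofReal ((t / 2) ^ q) ≤ ENNReal.ofReal (|u y| ^ q)} := fun y hy =>
      ENNReal.ofReal_le_ofReal (Real.rpow_le_rpow (by positivity) hy hq.le)
    have h2 : 0 < (t / 2) ^ q := by positivity
    calc volume bad ≤ _ := measure_mono h1
      _ ≤ (∫⁻ y, ENNReal.ofReal (|u y| ^ q)) / ENNReal.ofReal ((t / 2) ^ q) :=
        meas_ge_le_lintegral_div (by fun_prop) (by simpa using h2) ENNReal.ofReal_ne_top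
      _ ≤ ENNReal.ofReal a / ENNReal.ofReal ((t / 2) ^ q) := by gcongr
      _ = _ := by rw [hm, ENNReal.ofReal_div_of_pos h2]
  have hgood : ENNReal.ofReal m ≤ volume (Metric.ball x r \ bad) := by
    refine le_trans ?_ (le_measure_sdiff (μ := volume) (s₁ := Metric.ball x r) (s₂ := bad))
    rw [volume_ball_eq_ofReal x hr, hvol]
    refine le_trans ?_ (tsub_le_tsub_left hbadv _)
    rw [← ENNReal.ofReal_sub _ hm0.le]
    exact ENNReal.ofReal_le_ofReal (by linarith)
  have hS : MeasurableSet (Metric.ball x r \ bad) := measurableSet_ball.diff hbadm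
  rw [ENNReal.ofReal_mul (by positivity)]
  calc _ ≤ ENNReal.ofReal ((t / 2) ^ p / r ^ ((N : ℝ) + s * p)) * volume (Metric.ball x r \ bad) := by
        gcongr
    _ = ∫⁻ y in Metric.ball x r \ bad, ENNReal.ofReal ((t / 2) ^ p / r ^ ((N : ℝ) + s * p)) := by
        rw [setLIntegral_const]
    _ ≤ ∫⁻ y in Metric.ball x r \ bad,
        ENNReal.ofReal (|u x - u y| ^ p / ‖x - y‖ ^ ((N : ℝ) + s * p)) := by
        refine setLIntegral_mono' hS fun y hy => ENNReal.ofReal_le_ofReal ?_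
        have h1 : |u y| < t / 2 := not_le.1 hy.2
        have h2 : t / 2 ≤ |u x - u y| := by
          have := abs_sub_abs_le_abs_sub (u x) (u y)
          linarith
        have h3 : ‖x - y‖ ≤ r := by
          rw [norm_sub_rev, ← dist_eq_norm]; exact (Metric.mem_ball.1 hy.1).le
        have h4 : 0 < ‖x - y‖ := by
          rw [norm_pos_iff, sub_ne_zero]
          rintro rfl
          rw [sub_self, abs_zero] at h2
          linarith
        gcongr
    _ ≤ _ := setLIntegral_le_lintegral _ _

lemma critExp_pos (hsp : s * p < N) (hp : 0 < p) (hN : 0 < N) : 0 < critExp N s p := by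
  have : (0 : ℝ) < N := by exact_mod_cast hN
  exact div_pos (by positivity) (by linarith)

lemma lt_critExp (hs : 0 < s) (hsp : s * p < N) (hp : 0 < p) : p < critExp N s p := by
  rw [critExp, lt_div_iff₀ (by linarith)]
  have : 0 < p * (s * p) := by positivity
  nlinarith

/-- Pointwise form of the fractional Sobolev inequality. -/
lemma exists_rpow_critExp_le (hs : 0 < s) (hp : 0 < p) (hsp : s * p < N) (hN : 0 < N) :
    ∃ C : ℝ, 0 < C ∧ ∀ (u : EuclideanSpace ℝ (Fin N) → ℝ), Measurable u → ∀ a : ℝ, 0 < a →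
      ∫⁻ y, ENNReal.ofReal (|u y| ^ critExp N s p) ≤ ENNReal.ofReal a → ∀ x,
      ENNReal.ofReal (|u x| ^ critExp N s p) ≤ ENNReal.ofReal (C * a ^ (s * p / N)) *
        ∫⁻ y, ENNReal.ofReal (|u x - u y| ^ p / ‖x - y‖ ^ ((N : ℝ) + s * p)) := by
  set q := critExp N s p with hqdef
  have hq : 0 < q := critExp_pos hsp hp hN
  have hNR : (0 : ℝ) < N := by exact_mod_cast hN
  set ω := (volume (Metric.ball (0 : EuclideanSpace ℝ (Fin N)) 1)).toReal with hω
  have hω0 : 0 < ω := ENNReal.toReal_pos (Metric.measure_ball_pos volume _ one_pos).ne'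
    measure_ball_lt_top.ne
  set θ := s * p / N with hθ
  have hθ0 : 0 < θ := by positivity
  -- This relation, which characterises the critical exponent, makes all powers of |u x| cancel
  -- below.
  have hqθ : q * θ = q - p := by
    have : (N : ℝ) - s * p ≠ 0 := by linarith
    rw [hqdef, critExp, hθ, div_mul_div_comm, div_sub' this,
      div_eq_div_iff (mul_ne_zero this hNR.ne') this]
    ring
  refine ⟨2 ^ p * (2 / ω) * (2 / ω * 2 ^ q) ^ θ, by positivity, fun u hu a ha hA x => ?_⟩
  rcases eq_or_ne (u x) 0 with hx | hx
  · simp [hx, Real.zero_rpow hq.ne']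
  have ht0 : 0 < |u x| := abs_pos.2 hx
  set t := |u x| with ht
  set m := a / (t / 2) ^ q with hm
  have hm0 : 0 < m := by positivity
  set r := (2 * m / ω) ^ (1 / (N : ℝ)) with hr
  have hr0 : 0 < r := by positivity
  have hrN : r ^ N = 2 * m / ω := by
    rw [hr, ← Real.rpow_natCast, ← Real.rpow_mul (by positivity), one_div_mul_cancel hNR.ne',
      Real.rpow_one]
  have hvol : ω * r ^ N = 2 * m := by rw [hrN]; field_simp
  have hkey := lintegral_diffQuot_ge hs hp ha hu hA hq hx hr0 hvol
  refine le_trans ?_ (mul_le_mul_right hkey _)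
  rw [← ENNReal.ofReal_mul (by positivity)]
  -- With r chosen so that the ball has volume exactly 2m, the constant makes this an equality.
  refine ENNReal.ofReal_le_ofReal (le_of_eq ?_)
  have h1 : r ^ ((N : ℝ) + s * p) = 2 * m / ω * (2 * m / ω) ^ θ := by
    rw [Real.rpow_add hr0, Real.rpow_natCast, hrN, hr, ← Real.rpow_mul (by positivity)]
    congr 2
    rw [hθ]; ring
  have h2 : (2 * m / ω) ^ θ = (2 / ω * 2 ^ q) ^ θ * a ^ θ / (t ^ q / t ^ p) := by
    have e : 2 * m / ω = (2 / ω * 2 ^ q) * a / t ^ q := by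
      rw [hm, Real.div_rpow ht0.le zero_le_two]; field_simp
    rw [e, Real.div_rpow (by positivity) (by positivity), Real.mul_rpow (by positivity) ha.le,
      ← Real.rpow_mul ht0.le, hqθ, Real.rpow_sub ht0]
  rw [← ht, ← hm, h1, h2, Real.div_rpow ht0.le zero_le_two]
  have h3 : (2 / ω * 2 ^ q) ^ θ ≠ 0 := by positivity
  have h4 : a ^ θ ≠ 0 := by positivity
  have h5 : t ^ q ≠ 0 := by positivity
  have h6 : t ^ p ≠ 0 := by positivity
  have h7 : (2 : ℝ) ^ p ≠ 0 := by positivity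
  field_simp

lemma gagliardo_rpow (hp : 0 < p) (u : EuclideanSpace ℝ (Fin N) → ℝ) :
    gagliardo s p u ^ p = ∫⁻ z : EuclideanSpace ℝ (Fin N) × EuclideanSpace ℝ (Fin N),
      ENNReal.ofReal (|u z.1 - u z.2| ^ p / ‖z.1 - z.2‖ ^ ((N : ℝ) + s * p)) := by
  rw [gagliardo, ← ENNReal.rpow_mul, one_div_mul_cancel hp.ne', ENNReal.rpow_one]

lemma gagliardo_rpow_eq_lintegral_lintegral (hp : 0 < p) {u : EuclideanSpace ℝ (Fin N) → ℝ}
    (hu : Measurable u) : gagliardo s p u ^ p = ∫⁻ x, ∫⁻ y,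
      ENNReal.ofReal (|u x - u y| ^ p / ‖x - y‖ ^ ((N : ℝ) + s * p)) := by
  rw [gagliardo_rpow hp, Measure.volume_eq_prod, lintegral_prod]
  exact (by fun_prop : Measurable fun z : EuclideanSpace ℝ (Fin N) × EuclideanSpace ℝ (Fin N) =>
    ENNReal.ofReal (|u z.1 - u z.2| ^ p / ‖z.1 - z.2‖ ^ ((N : ℝ) + s * p))).aemeasurable

lemma eLpNorm_ofReal_eq {α : Type*} [MeasurableSpace α] {μ : Measure α} {q : ℝ} (hq : 0 < q)
    (u : α → ℝ) :
    eLpNorm u (ENNReal.ofReal q) μ = (∫⁻ x, ENNReal.ofReal (|u x| ^ q) ∂μ) ^ (1 / q) := by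
  rw [eLpNorm_eq_lintegral_rpow_enorm_toReal (by simpa using hq) ENNReal.ofReal_ne_top,
    ENNReal.toReal_ofReal hq.le]
  congr 1
  refine lintegral_congr fun x => ?_
  rw [Real.enorm_eq_ofReal_abs, ENNReal.ofReal_rpow_of_nonneg (abs_nonneg _) hq.le]

/-- The fractional Sobolev inequality for functions already known to be in `L^{p_s^*}`. -/
lemma exists_eLpNorm_critExp_le_of_ne_top (hs : 0 < s) (hp : 0 < p) (hsp : s * p < N)
    (hN : 0 < N) :
    ∃ K : ℝ≥0∞, K ≠ ∞ ∧ ∀ (u : EuclideanSpace ℝ (Fin N) → ℝ), Measurable u →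
      eLpNorm u (ENNReal.ofReal (critExp N s p)) volume ≠ ∞ →
      eLpNorm u (ENNReal.ofReal (critExp N s p)) volume ≤ K * gagliardo s p u := by
  obtain ⟨C, hC, h⟩ := exists_rpow_critExp_le hs hp hsp hN
  have hq : 0 < critExp N s p := critExp_pos hsp hp hN
  have hNR : (0 : ℝ) < N := by exact_mod_cast hN
  set q := critExp N s p with hqdef
  refine ⟨ENNReal.ofReal C ^ (1 / p), ENNReal.rpow_ne_top_of_nonneg (by positivity)
    ENNReal.ofReal_ne_top, fun u hu hfin => ?_⟩
  rw [eLpNorm_ofReal_eq hq] at hfin ⊢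
  set A := ∫⁻ x, ENNReal.ofReal (|u x| ^ q) with hA
  have hAtop : A ≠ ∞ := by
    intro hAt
    rw [hAt, ENNReal.top_rpow_of_pos (by positivity)] at hfin
    exact hfin rfl
  rcases eq_or_ne A 0 with hA0 | hA0
  · rw [hA0, ENNReal.zero_rpow_of_pos (by positivity)]; exact zero_le
  set a := A.toReal with ha
  have ha0 : 0 < a := ENNReal.toReal_pos hA0 hAtop
  have hAa : A = ENNReal.ofReal a := (ENNReal.ofReal_toReal hAtop).symm
  have h1 : A ≤ ENNReal.ofReal (C * a ^ (s * p / N)) * gagliardo s p u ^ p := by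
    rw [gagliardo_rpow_eq_lintegral_lintegral hp hu,
      ← lintegral_const_mul' _ _ ENNReal.ofReal_ne_top]
    exact lintegral_mono (h u hu a ha0 hAa.le)
  -- Integration gave A ≤ C A^(sp/N) [u]^p. Cancelling A^(sp/N), legitimate because A is finite and
  -- nonzero, leaves A^(p/q) ≤ C [u]^p.
  have hexp : s * p / N + p / q = 1 := by
    have : (N : ℝ) - s * p ≠ 0 := by linarith
    rw [hqdef, critExp]; field_simp; ring
  have h2 : A = ENNReal.ofReal (a ^ (s * p / N)) * ENNReal.ofReal (a ^ (p / q)) := by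
    rw [← ENNReal.ofReal_mul (by positivity), ← Real.rpow_add ha0, hexp, Real.rpow_one, hAa]
  have h3 : ENNReal.ofReal (a ^ (p / q)) ≤ ENNReal.ofReal C * gagliardo s p u ^ p := by
    rw [← ENNReal.mul_le_mul_iff_right (a := ENNReal.ofReal (a ^ (s * p / N)))
      (by simp only [ne_eq, ENNReal.ofReal_eq_zero, not_le]; positivity) ENNReal.ofReal_ne_top,
      ← h2, ← mul_assoc, ← ENNReal.ofReal_mul (by positivity), mul_comm (a ^ _)]
    exact h1
  have h4 := ENNReal.rpow_le_rpow h3 (by positivity : 0 ≤ 1 / p)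
  rw [ENNReal.mul_rpow_of_nonneg _ _ (by positivity : 0 ≤ 1 / p), ← ENNReal.rpow_mul,
    mul_one_div_cancel hp.ne', ENNReal.rpow_one, ENNReal.ofReal_rpow_of_pos (by positivity),
    ← Real.rpow_mul ha0.le] at h4
  refine le_trans (le_of_eq ?_) h4
  rw [hAa, ENNReal.ofReal_rpow_of_pos ha0]
  congr 2
  field_simp

lemma abs_clamp_sub_le (k a b : ℝ) : |max (min a k) (-k) - max (min b k) (-k)| ≤ |a - b| :=
  (abs_max_sub_max_le_abs _ _ _).trans
    ((abs_min_sub_min_le_max a k b k).trans (by simp))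

/-- Truncation is 1-Lipschitz. It serves to remove the a priori finiteness of the critical norm. -/
lemma gagliardo_clamp_le (hp : 0 < p) (u : EuclideanSpace ℝ (Fin N) → ℝ) (k : ℝ) :
    gagliardo s p (fun x => max (min (u x) k) (-k)) ≤ gagliardo s p u := by
  refine ENNReal.rpow_le_rpow (lintegral_mono fun z => ENNReal.ofReal_le_ofReal ?_) (by positivity)
  exact div_le_div_of_nonneg_right
    (Real.rpow_le_rpow (abs_nonneg _) (abs_clamp_sub_le _ _ _) hp.le) (by positivity)

/-- The fractional Sobolev inequality. -/
theorem exists_eLpNorm_critExp_le (hs : 0 < s) (hp : 1 < p) (hsp : s * p < N) (hN : 0 < N) :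
    ∃ K : ℝ≥0∞, K ≠ ∞ ∧ ∀ (u : EuclideanSpace ℝ (Fin N) → ℝ),
      MemLp u (ENNReal.ofReal p) volume →
      eLpNorm u (ENNReal.ofReal (critExp N s p)) volume ≤ K * gagliardo s p u := by
  have hp0 : 0 < p := by linarith
  obtain ⟨K, hK, h⟩ := exists_eLpNorm_critExp_le_of_ne_top hs hp0 hsp hN
  have hq : 0 < critExp N s p := critExp_pos hsp hp0 hN
  have hpq := lt_critExp hs hsp hp0
  set q := critExp N s p with hqdef
  have main : ∀ (u : EuclideanSpace ℝ (Fin N) → ℝ), Measurable u →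
      MemLp u (ENNReal.ofReal p) volume →
      eLpNorm u (ENNReal.ofReal q) volume ≤ K * gagliardo s p u := by
    intro u hu hup
    set v : ℕ → EuclideanSpace ℝ (Fin N) → ℝ := fun k x => max (min (u x) k) (-k) with hv
    have hvm : ∀ k, Measurable (v k) := fun k =>
      (hu.min measurable_const).max measurable_const
    -- Truncations of an L^p function are bounded, hence in L^q for q > p; Fatou passes their
    -- inequality to the limit.
    refine Lp.eLpNorm_le_of_ae_tendsto (u := atTop) (f := v) ?_
      (fun k => (hvm k).aestronglyMeasurable) ?_
    · refine Eventually.of_forall fun k => ?_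
      refine (h _ (hvm k) ?_).trans (by gcongr; exact gagliardo_clamp_le hp0 u k)
      rw [eLpNorm_ofReal_eq hq]
      refine ENNReal.rpow_ne_top_of_nonneg (by positivity) ?_
      have hle : ∀ x, |v k x| ≤ k := fun x =>
        abs_le.2 ⟨le_max_right _ _, max_le (min_le_right _ _)
          ((neg_nonpos.2 (Nat.cast_nonneg k)).trans (Nat.cast_nonneg k))⟩
      have hle' : ∀ x, |v k x| ≤ |u x| := fun x => by
        have := abs_clamp_sub_le (k : ℝ) (u x) 0
        simpa [hv] using this
      have hbd : ∫⁻ x, ENNReal.ofReal (|v k x| ^ q) ≤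
          ENNReal.ofReal ((k : ℝ) ^ (q - p)) * ∫⁻ x, ENNReal.ofReal (|u x| ^ p) := by
        rw [← lintegral_const_mul' _ _ ENNReal.ofReal_ne_top]
        refine lintegral_mono fun x => ?_
        simp only
        rw [← ENNReal.ofReal_mul (by positivity)]
        refine ENNReal.ofReal_le_ofReal ?_
        calc |v k x| ^ q = |v k x| ^ (q - p) * |v k x| ^ p := by
              rw [← Real.rpow_add_of_nonneg (abs_nonneg _) (by linarith) hp0.le, sub_add_cancel]
          _ ≤ (k : ℝ) ^ (q - p) * |u x| ^ p := by
              exact mul_le_mul (Real.rpow_le_rpow (abs_nonneg _) (hle x) (by linarith))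
                (Real.rpow_le_rpow (abs_nonneg _) (hle' x) hp0.le) (by positivity) (by positivity)
      refine ne_top_of_le_ne_top (ENNReal.mul_ne_top ENNReal.ofReal_ne_top ?_) hbd
      have := (integrable_abs_rpow hp hup).lintegral_lt_top
      exact this.ne
    · refine Eventually.of_forall fun x => ?_
      refine tendsto_const_nhds.congr' ?_
      filter_upwards [eventually_ge_atTop ⌈|u x|⌉₊] with k hk
      have hk' : |u x| ≤ k := (Nat.le_ceil _).trans (by exact_mod_cast hk)
      obtain ⟨h1, h2⟩ := abs_le.1 hk'
      simp only [hv]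
      rw [min_eq_left h2, max_eq_left h1]
  refine ⟨K, hK, fun u hup => ?_⟩
  have hae := hup.1.ae_eq_mk
  rw [eLpNorm_congr_ae hae, gagliardo_congr hae]
  exact main _ hup.1.stronglyMeasurable_mk.measurable ((memLp_congr_ae hae).1 hup)

end

/-! ### Cubes and the fractional Poincaré inequality. -/

section
variable {N : ℕ} {s p : ℝ}

/-- The half-open cube of side `h` with lower corner `h k`. -/
def cube (N : ℕ) (h : ℝ) (k : Fin N → ℤ) : Set (EuclideanSpace ℝ (Fin N)) :=
  WithLp.ofLp ⁻¹' Set.univ.pi fun i => Set.Ico (k i * h) ((k i + 1) * h)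

lemma mem_cube {h : ℝ} {k : Fin N → ℤ} {x : EuclideanSpace ℝ (Fin N)} :
    x ∈ cube N h k ↔ ∀ i, k i * h ≤ x i ∧ x i < (k i + 1) * h := by
  simp [cube]

lemma measurableSet_cube_pi (h : ℝ) (k : Fin N → ℤ) :
    MeasurableSet (Set.univ.pi fun i => Set.Ico (k i * h) ((k i + 1) * h)) :=
  MeasurableSet.univ_pi fun _ => measurableSet_Ico

lemma measurableSet_cube (h : ℝ) (k : Fin N → ℤ) : MeasurableSet (cube N h k) :=
  (PiLp.volume_preserving_ofLp (Fin N)).measurable (measurableSet_cube_pi h k)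

lemma volume_cube {h : ℝ} (hh : 0 < h) (k : Fin N → ℤ) :
    volume (cube N h k) = ENNReal.ofReal (h ^ N) := by
  rw [cube, (PiLp.volume_preserving_ofLp (Fin N)).measure_preimage
    (measurableSet_cube_pi h k).nullMeasurableSet, Real.volume_pi_Ico]
  have : ∀ i, (k i + 1) * h - k i * h = h := fun i => by ring
  simp only [this, Finset.prod_const, Finset.card_univ, Fintype.card_fin]
  rw [ENNReal.ofReal_pow hh.le]

lemma mem_cube_iff_floor {h : ℝ} (hh : 0 < h) {k : Fin N → ℤ} {x : EuclideanSpace ℝ (Fin N)} :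
    x ∈ cube N h k ↔ ∀ i, ⌊x i / h⌋ = k i := by
  rw [mem_cube]
  refine forall_congr' fun i => ?_
  rw [Int.floor_eq_iff, le_div_iff₀ hh, div_lt_iff₀ hh]

lemma pairwise_disjoint_cube {h : ℝ} (hh : 0 < h) :
    Pairwise (Function.onFun Disjoint (cube N h)) := by
  intro k l hkl
  refine Set.disjoint_left.2 fun x hk hl => hkl ?_
  rw [mem_cube_iff_floor hh] at hk hl
  ext i
  rw [← hk i, hl i]

lemma norm_sub_le_of_mem_cube {h : ℝ} (hh : 0 < h) {k : Fin N → ℤ}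
    {x y : EuclideanSpace ℝ (Fin N)} (hx : x ∈ cube N h k) (hy : y ∈ cube N h k) :
    ‖x - y‖ ≤ N * h := by
  rw [mem_cube] at hx hy
  rw [EuclideanSpace.norm_eq]
  refine Real.sqrt_le_iff.2 ⟨by positivity, ?_⟩
  have h1 : ∀ i ∈ Finset.univ, ‖(x - y) i‖ ^ 2 ≤ h ^ 2 := fun i _ => by
    rw [Real.norm_eq_abs, PiLp.sub_apply]
    have : |x i - y i| ≤ h := by
      have := hx i; have := hy i
      rw [abs_le]; constructor <;> linarith
    exact pow_le_pow_left₀ (abs_nonneg _) this 2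
  refine (Finset.sum_le_sum h1).trans ?_
  simp only [Finset.sum_const, Finset.card_univ, Fintype.card_fin, nsmul_eq_mul, mul_pow]
  gcongr
  rcases Nat.eq_zero_or_pos N with rfl | hN
  · simp
  · exact le_self_pow₀ (by exact_mod_cast hN) two_ne_zero

lemma exists_finset_subset_iUnion_cube {Ω : Set (EuclideanSpace ℝ (Fin N))}
    (hΩ : Bornology.IsBounded Ω) {h : ℝ} (hh : 0 < h) :
    ∃ K : Finset (Fin N → ℤ), Ω ⊆ ⋃ k ∈ K, cube N h k := by
  obtain ⟨R, hR⟩ := hΩ.exists_norm_le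
  refine ⟨Fintype.piFinset fun _ => Finset.Icc ⌊-R / h⌋ ⌊R / h⌋, fun x hx => ?_⟩
  simp only [Set.mem_iUnion]
  refine ⟨fun i => ⌊x i / h⌋, ?_, (mem_cube_iff_floor hh).2 fun i => rfl⟩
  rw [Fintype.mem_piFinset]
  intro i
  have h1 : |x i| ≤ R := (PiLp.norm_apply_le x i).trans (hR x hx)
  obtain ⟨h2, h3⟩ := abs_le.1 h1
  rw [Finset.mem_Icc]
  constructor <;> exact Int.floor_le_floor (by gcongr)

lemma abs_average_rpow_le {α : Type*} [MeasurableSpace α] {μ : Measure α} [IsFiniteMeasure μ]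
    [NeZero μ] (hp : 1 < p) {f : α → ℝ} (hf : MemLp f (ENNReal.ofReal p) μ) :
    |⨍ x, f x ∂μ| ^ p ≤ ⨍ x, |f x| ^ p ∂μ := by
  have h1 : |⨍ x, f x ∂μ| ≤ ⨍ x, |f x| ∂μ := by
    rw [average_eq, average_eq, smul_eq_mul, smul_eq_mul, abs_mul,
      abs_of_nonneg (by positivity : 0 ≤ (μ.real Set.univ)⁻¹)]
    gcongr
    exact abs_integral_le_integral_abs
  have hfi : Integrable f μ := hf.integrable (by simpa using hp.le)
  refine (Real.rpow_le_rpow (abs_nonneg _) h1 (by linarith)).trans ?_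
  exact (convexOn_rpow hp.le).map_average_le (f := fun x => |f x|)
    (Real.continuous_rpow_const (by linarith)).continuousOn isClosed_Ici
    (Eventually.of_forall fun x => Set.mem_Ici.2 (abs_nonneg _)) hfi.abs (integrable_abs_rpow hp hf)

lemma add_rpow_le_mul_rpow_add_rpow {a b : ℝ} (ha : 0 ≤ a) (hb : 0 ≤ b) (hp : 1 ≤ p) :
    (a + b) ^ p ≤ 2 ^ (p - 1) * (a ^ p + b ^ p) := by
  lift a to NNReal using ha
  lift b to NNReal using hb
  exact_mod_cast NNReal.rpow_add_le_mul_rpow_add_rpow a b hp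

/-- The fractional Poincaré inequality on a cube. -/
lemma setLIntegral_cube_le {h : ℝ} (hs : 0 < s) (hp : 1 < p) (hN : 0 < N) (hh : 0 < h)
    (k : Fin N → ℤ) {w : EuclideanSpace ℝ (Fin N) → ℝ} (hw : MemLp w (ENNReal.ofReal p) volume) :
    ∫⁻ x in cube N h k, ENNReal.ofReal (|w x| ^ p) ≤
      ENNReal.ofReal (2 ^ (p - 1) * (N : ℝ) ^ (N + s * p) * h ^ (s * p)) *
        (∫⁻ x in cube N h k, ∫⁻ y,
          ENNReal.ofReal (|w x - w y| ^ p / ‖x - y‖ ^ ((N : ℝ) + s * p))) +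
      ENNReal.ofReal (2 ^ (p - 1) * h ^ N * |⨍ x in cube N h k, w x| ^ p) := by
  have hp0 : 0 < p := by linarith
  have hNR : (0 : ℝ) < N := by exact_mod_cast hN
  set Q := cube N h k with hQ
  have hV : volume Q = ENNReal.ofReal (h ^ N) := volume_cube hh k
  have hVr : (volume.restrict Q).real Set.univ = h ^ N := by
    rw [measureReal_restrict_apply_univ, measureReal_def, hV, ENNReal.toReal_ofReal (by positivity)]
  have : IsFiniteMeasure (volume.restrict Q) :=
    ⟨by rw [Measure.restrict_apply_univ, hV]; exact ENNReal.ofReal_lt_top⟩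
  have : NeZero (volume.restrict Q) := ⟨by
    intro h0
    rw [h0] at hVr
    have : 0 < h ^ N := by positivity
    simp at hVr
    linarith⟩
  set A := ⨍ x in Q, w x with hA
  have hwQ : MemLp w (ENNReal.ofReal p) (volume.restrict Q) := hw.restrict Q
  have hwi : Integrable w (volume.restrict Q) := hwQ.integrable (by simpa using hp.le)
  have hcw : ∀ x, MemLp (fun y => w x - w y) (ENNReal.ofReal p) (volume.restrict Q) := fun x =>
    (memLp_const (w x)).sub hwQ
  set c := 2 ^ (p - 1) * (N : ℝ) ^ (N + s * p) * h ^ (s * p) with hc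
  have hc' : c * h ^ N = 2 ^ (p - 1) * ((N : ℝ) * h) ^ ((N : ℝ) + s * p) := by
    rw [Real.mul_rpow hNR.le hh.le, Real.rpow_add hh, Real.rpow_natCast, hc]; ring
  have hpt : ∀ x ∈ Q, ENNReal.ofReal (|w x| ^ p) ≤
      ENNReal.ofReal c * (∫⁻ y, ENNReal.ofReal (|w x - w y| ^ p / ‖x - y‖ ^ ((N : ℝ) + s * p))) +
        ENNReal.ofReal (2 ^ (p - 1) * |A| ^ p) := by
    intro x hx
    -- Jensen applied to this average bounds |w x − A|^p by the mean of |w x − w y|^p over the cube.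
    have h1 : w x - A = ⨍ y in Q, (w x - w y) := by
      rw [average_eq, integral_sub (integrable_const _) hwi, integral_const, hVr, hA,
        average_eq, hVr]
      have : h ^ N ≠ 0 := by positivity
      simp only [smul_eq_mul]
      field_simp
    have h2 : |w x - A| ^ p ≤ (h ^ N)⁻¹ * ∫ y in Q, |w x - w y| ^ p := by
      have := abs_average_rpow_le hp (hcw x)
      rwa [← h1, average_eq _ (fun y => |w x - w y| ^ p), hVr, smul_eq_mul] at this
    have h3 : |w x| ^ p ≤ 2 ^ (p - 1) * (|w x - A| ^ p + |A| ^ p) := by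
      have h4 : |w x| ≤ |w x - A| + |A| := by
        calc |w x| = |(w x - A) + A| := by rw [sub_add_cancel]
          _ ≤ _ := abs_add_le _ _
      exact (Real.rpow_le_rpow (abs_nonneg _) h4 hp0.le).trans
        (add_rpow_le_mul_rpow_add_rpow (abs_nonneg _) (abs_nonneg _) hp.le)
    -- On the cube ‖x − y‖ ≤ N h, so the kernel can be inserted at the cost of (N h)^(N + sp);
    -- dividing by the volume h^N leaves the small factor h^(sp).
    have h5 : ENNReal.ofReal (∫ y in Q, |w x - w y| ^ p) ≤
        ENNReal.ofReal (((N : ℝ) * h) ^ ((N : ℝ) + s * p)) *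
          ∫⁻ y, ENNReal.ofReal (|w x - w y| ^ p / ‖x - y‖ ^ ((N : ℝ) + s * p)) := by
      rw [ofReal_integral_eq_lintegral_ofReal (integrable_abs_rpow hp (hcw x))
        (Eventually.of_forall fun y => by positivity),
        ← lintegral_const_mul' _ _ ENNReal.ofReal_ne_top]
      refine le_trans (setLIntegral_mono' (measurableSet_cube h k) fun y hy => ?_)
        (setLIntegral_le_lintegral Q _)
      rw [← ENNReal.ofReal_mul (by positivity)]
      refine ENNReal.ofReal_le_ofReal ?_
      rcases eq_or_ne x y with rfl | hxy
      · rw [sub_self, abs_zero, Real.zero_rpow hp0.ne']; simp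
      · have h6 : 0 < ‖x - y‖ := norm_pos_iff.2 (sub_ne_zero.2 hxy)
        rw [mul_div_assoc', le_div_iff₀ (by positivity), mul_comm]
        gcongr
        exact norm_sub_le_of_mem_cube hh hx hy
    calc ENNReal.ofReal (|w x| ^ p)
        ≤ ENNReal.ofReal (2 ^ (p - 1) * (h ^ N)⁻¹ * (∫ y in Q, |w x - w y| ^ p) +
            2 ^ (p - 1) * |A| ^ p) := by
          refine ENNReal.ofReal_le_ofReal (h3.trans ?_)
          have := mul_le_mul_of_nonneg_left h2 (by positivity : (0 : ℝ) ≤ 2 ^ (p - 1))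
          linarith
      _ ≤ ENNReal.ofReal (2 ^ (p - 1) * (h ^ N)⁻¹) * ENNReal.ofReal (∫ y in Q, |w x - w y| ^ p) +
            ENNReal.ofReal (2 ^ (p - 1) * |A| ^ p) := by
          rw [← ENNReal.ofReal_mul (by positivity)]
          exact ENNReal.ofReal_add_le
      _ ≤ ENNReal.ofReal (2 ^ (p - 1) * (h ^ N)⁻¹) *
          (ENNReal.ofReal (((N : ℝ) * h) ^ ((N : ℝ) + s * p)) *
          ∫⁻ y, ENNReal.ofReal (|w x - w y| ^ p / ‖x - y‖ ^ ((N : ℝ) + s * p))) +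
            ENNReal.ofReal (2 ^ (p - 1) * |A| ^ p) := by gcongr
      _ = _ := by
          rw [← mul_assoc, ← ENNReal.ofReal_mul (by positivity)]
          congr 3
          have : h ^ N ≠ 0 := by positivity
          rw [mul_right_comm, ← hc']
          field_simp
  refine (setLIntegral_mono' (measurableSet_cube h k) hpt).trans ?_
  rw [lintegral_add_right _ measurable_const, lintegral_const_mul' _ _ ENNReal.ofReal_ne_top,
    setLIntegral_const, hV, ← ENNReal.ofReal_mul (by positivity)]
  rw [mul_right_comm]

/-- A function vanishing outside a bounded set is controlled in `L^p` by its Gagliardo seminorm,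
with a small constant, and by finitely many averages. -/
lemma exists_finset_lintegral_rpow_le {Ω : Set (EuclideanSpace ℝ (Fin N))}
    (hΩ : Bornology.IsBounded Ω) {h : ℝ} (hs : 0 < s) (hp : 1 < p) (hN : 0 < N) (hh : 0 < h) :
    ∃ K : Finset (Fin N → ℤ), ∀ w : EuclideanSpace ℝ (Fin N) → ℝ,
      MemLp w (ENNReal.ofReal p) volume → Measurable w → (∀ᵐ x, x ∉ Ω → w x = 0) →
      ∫⁻ x, ENNReal.ofReal (|w x| ^ p) ≤
      ENNReal.ofReal (2 ^ (p - 1) * (N : ℝ) ^ (N + s * p) * h ^ (s * p)) * gagliardo s p w ^ p +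
        ENNReal.ofReal (∑ k ∈ K, 2 ^ (p - 1) * h ^ N * |⨍ x in cube N h k, w x| ^ p) := by
  obtain ⟨K, hK⟩ := exists_finset_subset_iUnion_cube hΩ hh
  refine ⟨K, fun w hw hwm hw0 => ?_⟩
  have hp0 : 0 < p := by linarith
  have hdisj : Set.PairwiseDisjoint (↑K) (cube N h) := fun k _ l _ hkl =>
    pairwise_disjoint_cube hh hkl
  have hm : ∀ k ∈ K, MeasurableSet (cube N h k) := fun k _ => measurableSet_cube h k
  have h1 : ∫⁻ x, ENNReal.ofReal (|w x| ^ p) =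
      ∑ k ∈ K, ∫⁻ x in cube N h k, ENNReal.ofReal (|w x| ^ p) := by
    rw [← lintegral_biUnion_finset hdisj hm, ← lintegral_indicator (K.measurableSet_biUnion hm)]
    refine lintegral_congr_ae ?_
    filter_upwards [hw0] with x hx
    by_cases hxK : x ∈ ⋃ k ∈ K, cube N h k
    · rw [Set.indicator_of_mem hxK]
    · rw [Set.indicator_of_notMem hxK, hx fun hxΩ => hxK (hK hxΩ), abs_zero,
        Real.zero_rpow hp0.ne', ENNReal.ofReal_zero]
  rw [h1, ENNReal.ofReal_sum_of_nonneg fun k _ => by positivity]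
  refine (Finset.sum_le_sum fun k _ => setLIntegral_cube_le hs hp hN hh k hw).trans ?_
  -- The inner integrals run over the whole space, so the sum over disjoint cubes is at most the
  -- full seminorm.
  rw [Finset.sum_add_distrib, ← Finset.mul_sum, ← lintegral_biUnion_finset hdisj hm,
    gagliardo_rpow_eq_lintegral_lintegral hp0 hwm]
  gcongr
  exact Measure.restrict_le_self

end

/-! ### Embeddings of `X` and compactness in L^p. -/

lemma diffQuot_congr {N : ℕ} {s p : ℝ} {u v : EuclideanSpace ℝ (Fin N) → ℝ} (h : u =ᵐ[volume] v) :
    diffQuot s p u =ᵐ[volume] diffQuot s p v := by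
  filter_upwards [ae_fst_snd h] with z hz
  simp only [diffQuot, hz.1, hz.2]

section
variable {N : ℕ} {s p : ℝ} [hp : Fact (1 < p)] {Ω : Set (EuclideanSpace ℝ (Fin N))}

lemma X.memLp (u : X N s p Ω) : MemLp u.toFun (ENNReal.ofReal p) volume := Lp.memLp u.toLp

lemma X.ae_eq_zero (u : X N s p Ω) : ∀ᵐ x, x ∉ Ω → u.toFun x = 0 := u.2.2

lemma X.coeFn_add (u v : X N s p Ω) : (u + v).toFun =ᵐ[volume] u.toFun + v.toFun :=
  Lp.coeFn_add u.toLp v.toLp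

lemma X.coeFn_smul (c : ℝ) (u : X N s p Ω) : (c • u).toFun =ᵐ[volume] c • u.toFun :=
  Lp.coeFn_smul c u.toLp

lemma X.coeFn_sub (u v : X N s p Ω) : (u - v).toFun =ᵐ[volume] u.toFun - v.toFun :=
  Lp.coeFn_sub u.toLp v.toLp

lemma X.gagliardo_ne_top (u : X N s p Ω) : gagliardo s p u.toFun ≠ ∞ := u.2.1.ne

lemma X.gagliardo_eq (u : X N s p Ω) : gagliardo s p u.toFun = ENNReal.ofReal ‖u‖ :=
  (ENNReal.ofReal_toReal u.gagliardo_ne_top).symm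

lemma X.memLp_diffQuot (u : X N s p Ω) :
    MemLp (diffQuot s p u.toFun) (ENNReal.ofReal p) volume := by
  refine ⟨aestronglyMeasurable_diffQuot u.memLp.1, ?_⟩
  rw [← gagliardo_eq_eLpNorm hp.out]
  exact u.gagliardo_ne_top.lt_top

lemma one_le_ofReal_of_fact : Fact (1 ≤ ENNReal.ofReal p) := ⟨by simpa using hp.out.le⟩

lemma X.norm_toLp_diffQuot (u : X N s p Ω) :
    ‖(X.memLp_diffQuot u).toLp (diffQuot s p u.toFun)‖ = ‖u‖ := by
  rw [Lp.norm_toLp, ← gagliardo_eq_eLpNorm hp.out, X.norm_def]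

lemma X.toLp_sub (u v : X N s p Ω) : (u - v).toLp = u.toLp - v.toLp := rfl

/-- Hölder's inequality on the bounded set `Ω`. -/
lemma exists_eLpNorm_le_eLpNorm (hΩm : MeasurableSet Ω) (hΩb : Bornology.IsBounded Ω) {q : ℝ}
    (hpq : p < q) : ∃ K : ℝ≥0∞, K ≠ ∞ ∧ ∀ u : X N s p Ω,
      eLpNorm u.toFun (ENNReal.ofReal p) volume ≤
        K * eLpNorm u.toFun (ENNReal.ofReal q) volume := by
  have hp0 : 0 < p := by linarith [hp.out]
  refine ⟨volume Ω ^ (1 / p - 1 / q), ENNReal.rpow_ne_top_of_nonneg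
    (sub_nonneg.2 (one_div_le_one_div_of_le hp0 hpq.le)) hΩb.measure_lt_top.ne, fun u => ?_⟩
  have e : ∀ r : ℝ≥0∞, eLpNorm u.toFun r (volume.restrict Ω) = eLpNorm u.toFun r volume :=
    fun r => by
      rw [← eLpNorm_indicator_eq_eLpNorm_restrict hΩm]
      refine eLpNorm_congr_ae ?_
      filter_upwards [u.ae_eq_zero] with x hx
      by_cases hxΩ : x ∈ Ω
      · rw [Set.indicator_of_mem hxΩ]
      · rw [Set.indicator_of_notMem hxΩ, hx hxΩ]
  have := eLpNorm_le_eLpNorm_mul_rpow_measure_univ (μ := volume.restrict Ω)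
    (ENNReal.ofReal_le_ofReal hpq.le) u.memLp.1.restrict
  rwa [e, e, Measure.restrict_apply_univ, ENNReal.toReal_ofReal hp0.le,
    ENNReal.toReal_ofReal (by linarith), mul_comm] at this

lemma integrableOn_cube {h : ℝ} (hh : 0 < h) (k : Fin N → ℤ) (u : X N s p Ω) :
    IntegrableOn u.toFun (cube N h k) := by
  have : IsFiniteMeasure (volume.restrict (cube N h k)) :=
    ⟨by rw [Measure.restrict_apply_univ, volume_cube hh]; exact ENNReal.ofReal_lt_top⟩
  exact (u.memLp.restrict _).integrable (by simpa using hp.out.le)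

lemma average_cube_sub {h : ℝ} (hh : 0 < h) (k : Fin N → ℤ) (u v : X N s p Ω) :
    ⨍ x in cube N h k, (u - v).toFun x =
      (⨍ x in cube N h k, u.toFun x) - ⨍ x in cube N h k, v.toFun x := by
  rw [average_congr (ae_restrict_of_ae (X.coeFn_sub u v))]
  simp only [average_eq, Pi.sub_apply]
  rw [integral_sub (integrableOn_cube hh k u) (integrableOn_cube hh k v), smul_sub]

variable [NeZero N]

/-- The isometric embedding of `X_p^s(Ω)` into `L^p(ℝ^{2N})`. -/
noncomputable def X.diffQuotL [Fact (1 ≤ ENNReal.ofReal p)] : X N s p Ω →L[ℝ] Lp ℝ (ENNReal.ofReal p)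
    (volume : Measure (EuclideanSpace ℝ (Fin N) × EuclideanSpace ℝ (Fin N))) :=
  LinearMap.mkContinuous
    { toFun := fun u => (X.memLp_diffQuot u).toLp (diffQuot s p u.toFun)
      map_add' := fun u v => by
        rw [← MemLp.toLp_add, MemLp.toLp_eq_toLp_iff, ← diffQuot_add]
        exact diffQuot_congr (X.coeFn_add u v)
      map_smul' := fun c u => by
        rw [RingHom.id_apply, ← MemLp.toLp_const_smul, MemLp.toLp_eq_toLp_iff, ← diffQuot_smul]
        exact diffQuot_congr (X.coeFn_smul c u) }
    1 (fun u => by rw [one_mul]; exact (X.norm_toLp_diffQuot u).le)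

lemma X.coeFn_diffQuotL [Fact (1 ≤ ENNReal.ofReal p)] (u : X N s p Ω) :
    X.diffQuotL u =ᵐ[volume] diffQuot s p u.toFun :=
  MemLp.coeFn_toLp (X.memLp_diffQuot u)

lemma X.norm_diffQuotL [Fact (1 ≤ ENNReal.ofReal p)] (u : X N s p Ω) : ‖X.diffQuotL u‖ = ‖u‖ :=
  X.norm_toLp_diffQuot u

/-- A continuous embedding of `X_p^s(Ω)` into `L^r(ℝ^N)`, given the corresponding inequality. -/
noncomputable def X.toLpL (r : ℝ) [Fact (1 ≤ ENNReal.ofReal r)] {K : ℝ≥0∞} (hK : K ≠ ∞)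
    (h : ∀ u : X N s p Ω, eLpNorm u.toFun (ENNReal.ofReal r) volume ≤ K * gagliardo s p u.toFun) :
    X N s p Ω →L[ℝ] Lp ℝ (ENNReal.ofReal r) (volume : Measure (EuclideanSpace ℝ (Fin N))) :=
  have hm : ∀ u : X N s p Ω, MemLp u.toFun (ENNReal.ofReal r) volume := fun u =>
    ⟨u.memLp.1, (h u).trans_lt (ENNReal.mul_lt_top hK.lt_top u.gagliardo_ne_top.lt_top)⟩
  LinearMap.mkContinuous
    { toFun := fun u => (hm u).toLp u.toFun
      map_add' := fun u v => by
        rw [← MemLp.toLp_add, MemLp.toLp_eq_toLp_iff]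
        exact X.coeFn_add u v
      map_smul' := fun c u => by
        rw [RingHom.id_apply, ← MemLp.toLp_const_smul, MemLp.toLp_eq_toLp_iff]
        exact X.coeFn_smul c u }
    K.toReal (fun u => by
      rw [LinearMap.coe_mk, AddHom.coe_mk, Lp.norm_toLp, X.norm_def, ← ENNReal.toReal_mul]
      exact ENNReal.toReal_mono (ENNReal.mul_ne_top hK u.gagliardo_ne_top) (h u))

section
variable {r : ℝ} [Fact (1 ≤ ENNReal.ofReal r)] {K : ℝ≥0∞} {hK : K ≠ ∞}
  {h : ∀ u : X N s p Ω, eLpNorm u.toFun (ENNReal.ofReal r) volume ≤ K * gagliardo s p u.toFun}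

lemma X.coeFn_toLpL (u : X N s p Ω) : X.toLpL r hK h u =ᵐ[volume] u.toFun :=
  MemLp.coeFn_toLp
    ⟨u.memLp.1, (h u).trans_lt (ENNReal.mul_lt_top hK.lt_top u.gagliardo_ne_top.lt_top)⟩

lemma X.norm_toLpL (u : X N s p Ω) : ‖X.toLpL r hK h u‖ = u.lnorm r := by
  rw [Lp.norm_def, eLpNorm_congr_ae (X.coeFn_toLpL u), toReal_eLpNorm u.memLp.1]
  rfl

end

lemma bestConst_nonneg : 0 ≤ bestConst N s p Ω :=
  Real.iInf_nonneg fun _ => div_nonneg (Real.rpow_nonneg (norm_nonneg _) _)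
    (Real.rpow_nonneg lpNorm_nonneg _)

/-- If the critical norm vanishes the inequality is trivial; otherwise u ≠ 0 and its quotient, with
a positive denominator, competes in the infimum. -/
lemma bestConst_mul_le (u : X N s p Ω) :
    bestConst N s p Ω * u.lnorm (critExp N s p) ^ p ≤ ‖u‖ ^ p := by
  have hp0 : 0 < p := by linarith [hp.out]
  have h0 : 0 ≤ u.lnorm (critExp N s p) := lpNorm_nonneg
  rcases h0.eq_or_lt with h | h
  · rw [← h, Real.zero_rpow hp0.ne', mul_zero]; positivity
  · have hu : u ≠ 0 := by
      rintro rfl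
      have h1 : (0 : X N s p Ω).toFun =ᵐ[volume] 0 := Lp.coeFn_zero _ _ _
      have h2 : (0 : X N s p Ω).lnorm (critExp N s p) = 0 := by
        rw [X.lnorm, ← toReal_eLpNorm (X.memLp _).1, eLpNorm_congr_ae h1]; simp
      exact h.ne' h2
    rw [← le_div_iff₀ (by positivity)]
    exact ciInf_le (f := fun u : {u : X N s p Ω // u ≠ 0} =>
        ‖u.1‖ ^ p / (u.1.lnorm (critExp N s p)) ^ p)
      ⟨0, by
        rintro _ ⟨v, rfl⟩
        exact div_nonneg (Real.rpow_nonneg (norm_nonneg _) _)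
          (Real.rpow_nonneg lpNorm_nonneg _)⟩ ⟨u, hu⟩

/-- `L^p` control of `X_p^s(Ω)` by the norm, with a small constant, and finitely many averages. -/
lemma X.exists_finset_norm_toLp_rpow_le (hs : 0 < s) (hΩ : Bornology.IsBounded Ω) {h : ℝ}
    (hh : 0 < h) :
    ∃ K : Finset (Fin N → ℤ), ∀ w : X N s p Ω, ‖w.toLp‖ ^ p ≤
      2 ^ (p - 1) * (N : ℝ) ^ (N + s * p) * h ^ (s * p) * ‖w‖ ^ p +
        ∑ k ∈ K, 2 ^ (p - 1) * h ^ N * |⨍ x in cube N h k, w.toFun x| ^ p := by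
  have hp0 : 0 < p := by linarith [hp.out]
  obtain ⟨K, hK⟩ := exists_finset_lintegral_rpow_le hΩ hs hp.out (Nat.pos_of_neZero N) hh
  refine ⟨K, fun w => ?_⟩
  have hm := (Lp.stronglyMeasurable w.toLp).measurable
  have := hK w.toFun w.memLp hm w.ae_eq_zero
  rw [w.gagliardo_eq, ENNReal.ofReal_rpow_of_nonneg (norm_nonneg _) hp0.le,
    ← ENNReal.ofReal_mul (by positivity), ← ENNReal.ofReal_add (by positivity)
      (Finset.sum_nonneg fun k _ => by positivity),
    ← ofReal_integral_eq_lintegral_ofReal (integrable_abs_rpow hp.out w.memLp)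
      (Eventually.of_forall fun x => by positivity)] at this
  rw [norm_rpow_eq_integral hp.out]
  refine (ENNReal.ofReal_le_ofReal_iff ?_).1 this
  exact add_nonneg (by positivity) (Finset.sum_nonneg fun k _ => by positivity)

/-- Along a bounded sequence each cube average stays in a fixed compact interval, which permits the
extraction of convergent averages. -/
lemma exists_average_cube_le [Fact (1 ≤ ENNReal.ofReal p)] {h C : ℝ} (hh : 0 < h)
    (hC : ∀ u : X N s p Ω, ‖u.toLp‖ ≤ C * ‖u‖) (hC0 : 0 ≤ C) (k : Fin N → ℤ) :
    ∃ B, ∀ u : X N s p Ω, |⨍ x in cube N h k, u.toFun x| ≤ B * ‖u‖ := by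
  have hp0 : 0 < p := by linarith [hp.out]
  have hV := volume_cube hh k
  have hVr : (volume.restrict (cube N h k)).real Set.univ = h ^ N := by
    rw [measureReal_restrict_apply_univ, measureReal_def, hV, ENNReal.toReal_ofReal (by positivity)]
  have : IsFiniteMeasure (volume.restrict (cube N h k)) :=
    ⟨by rw [Measure.restrict_apply_univ, hV]; exact ENNReal.ofReal_lt_top⟩
  have : NeZero (volume.restrict (cube N h k)) := ⟨by
    intro h0
    rw [h0] at hVr
    have : 0 < h ^ N := by positivity
    simp at hVr
    linarith⟩
  refine ⟨((h ^ N)⁻¹) ^ (1 / p) * C, fun u => ?_⟩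
  rw [← Real.rpow_le_rpow_iff (abs_nonneg _) (by positivity) hp0]
  refine (abs_average_rpow_le hp.out (u.memLp.restrict _)).trans ?_
  rw [average_eq, hVr, smul_eq_mul, mul_assoc, Real.mul_rpow (by positivity) (by positivity),
    ← Real.rpow_mul (by positivity), one_div_mul_cancel hp0.ne', Real.rpow_one]
  gcongr
  have h1 : ‖u.toLp‖ ^ p ≤ (C * ‖u‖) ^ p := Real.rpow_le_rpow (norm_nonneg _) (hC u) hp0.le
  refine le_trans ?_ h1
  rw [norm_rpow_eq_integral hp.out]
  exact setIntegral_le_integral (integrable_abs_rpow hp.out u.memLp)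
    (Eventually.of_forall fun x => by positivity)

/-- Bounded sequences of `X_p^s(Ω)` have subsequences that are Cauchy in `L^p`. -/
lemma X.exists_subseq_cauchySeq [Fact (1 ≤ ENNReal.ofReal p)] (hs : 0 < s)
    (hΩ : Bornology.IsBounded Ω) {C R : ℝ} (hC : ∀ u : X N s p Ω, ‖u.toLp‖ ≤ C * ‖u‖) (hC0 : 0 ≤ C)
    (u : ℕ → X N s p Ω) (hR : ∀ j, ‖u j‖ ≤ R) :
    ∃ φ : ℕ → ℕ, StrictMono φ ∧ CauchySeq fun j => (u (φ j)).toLp := by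
  have hp0 : 0 < p := by linarith [hp.out]
  have hR0 : 0 ≤ R := (norm_nonneg _).trans (hR 0)
  have hh : ∀ m : ℕ, (0 : ℝ) < 1 / (m + 1) := fun m => Nat.one_div_pos_of_nat
  choose B hB using fun i : ℕ × (Fin N → ℤ) => exists_average_cube_le (hh i.1) hC hC0 i.2
  set F : ℕ → ℕ × (Fin N → ℤ) → ℝ := fun j i => ⨍ x in cube N (1 / (i.1 + 1)) i.2, (u j).toFun x
    with hF
  -- All averages, over cubes of every side 1/(m + 1), form a point in a countable product of
  -- compact intervals; its sequential compactness replaces a diagonal argument.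
  have hcomp : IsCompact (Set.univ.pi fun i => Set.Icc (-(|B i| * R)) (|B i| * R)) :=
    isCompact_univ_pi fun i => isCompact_Icc
  obtain ⟨F₀, -, φ, hφ, hlim⟩ := hcomp.tendsto_subseq (x := F) fun j i _ => by
    refine abs_le.1 ?_
    exact (hB i (u j)).trans (mul_le_mul (le_abs_self _) (hR j) (norm_nonneg _) (abs_nonneg _))
  rw [tendsto_pi_nhds] at hlim
  refine ⟨φ, hφ, ?_⟩
  rw [cauchySeq_iff_tendsto_dist_atTop_0]
  have key : Tendsto (fun n : ℕ × ℕ => ‖(u (φ n.1)).toLp - (u (φ n.2)).toLp‖ ^ p)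
      atTop (𝓝 0) := by
    rw [Metric.tendsto_nhds]
    intro ε hε
    set c := 2 ^ (p - 1) * (N : ℝ) ^ (N + s * p) with hc
    have hm : Tendsto (fun m : ℕ => c * (1 / ((m : ℝ) + 1)) ^ (s * p) * (2 * R) ^ p) atTop (𝓝 0) := by
      have := ((tendsto_one_div_add_atTop_nhds_zero_nat (𝕜 := ℝ)).rpow_const (p := s * p)
        (Or.inr (by positivity))).const_mul c |>.mul_const ((2 * R) ^ p)
      rwa [Real.zero_rpow (by positivity), mul_zero, zero_mul] at this
    -- The side is fixed first, making the seminorm term less than ε/2 uniformly in the indices; the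
    -- remaining finitely many averages converge.
    obtain ⟨m, hmε⟩ := (hm.eventually (gt_mem_nhds (by positivity : 0 < ε / 2))).exists
    obtain ⟨K, hK⟩ := X.exists_finset_norm_toLp_rpow_le (N := N) (p := p) hs hΩ (hh m)
    have hsum : Tendsto (fun n : ℕ × ℕ => ∑ k ∈ K, 2 ^ (p - 1) * (1 / ((m : ℝ) + 1)) ^ N *
        |F (φ n.1) (m, k) - F (φ n.2) (m, k)| ^ p) atTop (𝓝 0) := by
      have h0 : (0 : ℝ) = ∑ k ∈ K, 0 := Finset.sum_const_zero.symm
      rw [h0]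
      refine tendsto_finsetSum K fun k _ => ?_
      have h1 : Tendsto (fun n : ℕ × ℕ => F (φ n.1) (m, k)) atTop (𝓝 (F₀ (m, k))) := by
        rw [← prod_atTop_atTop_eq]; exact (hlim (m, k)).comp tendsto_fst
      have h2 : Tendsto (fun n : ℕ × ℕ => F (φ n.2) (m, k)) atTop (𝓝 (F₀ (m, k))) := by
        rw [← prod_atTop_atTop_eq]; exact (hlim (m, k)).comp tendsto_snd
      have h3 := (((h1.sub h2).abs.rpow_const (p := p) (Or.inr hp0.le))).const_mul
        (2 ^ (p - 1) * (1 / ((m : ℝ) + 1)) ^ N)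
      rwa [sub_self, abs_zero, Real.zero_rpow hp0.ne', mul_zero] at h3
    filter_upwards [hsum.eventually (gt_mem_nhds (by positivity : 0 < ε / 2))] with n hn
    rw [Real.dist_0_eq_abs, abs_of_nonneg (by positivity), ← X.toLp_sub]
    refine (hK _).trans_lt ?_
    simp only [average_cube_sub (hh m)]
    have h4 : ‖u (φ n.1) - u (φ n.2)‖ ≤ 2 * R := by
      refine (norm_sub_le _ _).trans ?_
      linarith [hR (φ n.1), hR (φ n.2)]
    have h5 : c * (1 / ((m : ℝ) + 1)) ^ (s * p) * ‖u (φ n.1) - u (φ n.2)‖ ^ p ≤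
        c * (1 / ((m : ℝ) + 1)) ^ (s * p) * (2 * R) ^ p := by gcongr
    simp only [hF] at hn
    linarith
  have h := key.rpow_const (p := 1 / p) (Or.inr (by positivity))
  rw [Real.zero_rpow (by positivity)] at h
  refine h.congr fun n => ?_
  rw [← Real.rpow_mul (norm_nonneg _), mul_one_div_cancel hp0.ne', Real.rpow_one, dist_eq_norm]

/-- The compact embedding of `X_p^s(Ω)` into `L^p`. -/
lemma X.exists_subseq_tendsto [Fact (1 ≤ ENNReal.ofReal p)] (hs : 0 < s)
    (hΩ : Bornology.IsBounded Ω) {C R : ℝ} (hC : ∀ u : X N s p Ω, ‖u.toLp‖ ≤ C * ‖u‖) (hC0 : 0 ≤ C)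
    (u : ℕ → X N s p Ω) (hR : ∀ j, ‖u j‖ ≤ R) :
    ∃ (w : X N s p Ω) (φ : ℕ → ℕ), StrictMono φ ∧
      Tendsto (fun j => (u (φ j)).toLp) atTop (𝓝 w.toLp) ∧
      ∀ᵐ x, Tendsto (fun j => (u (φ j)).toFun x) atTop (𝓝 (w.toFun x)) := by
  obtain ⟨φ, hφ, hcau⟩ := X.exists_subseq_cauchySeq hs hΩ hC hC0 u hR
  obtain ⟨g, hg⟩ := cauchySeq_tendsto_of_complete hcau
  obtain ⟨ψ, hψ, hae⟩ := (tendstoInMeasure_of_tendsto_Lp hg).exists_seq_tendsto_ae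
  have hae' : ∀ᵐ x, Tendsto (fun j => (u (φ (ψ j))).toFun x) atTop (𝓝 (g x)) := hae
  -- Fatou for the difference quotients keeps the limit in the space.
  have hgag : gagliardo s p g ≤ ENNReal.ofReal R := by
    rw [gagliardo_eq_eLpNorm hp.out]
    refine Lp.eLpNorm_le_of_ae_tendsto (u := atTop)
      (f := fun j => diffQuot s p (u (φ (ψ j))).toFun) ?_
      (fun j => (X.memLp_diffQuot _).1) ?_
    · refine Eventually.of_forall fun j => ?_
      rw [← gagliardo_eq_eLpNorm hp.out, X.gagliardo_eq]
      exact ENNReal.ofReal_le_ofReal (hR _)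
    · filter_upwards [ae_fst_snd hae'] with z hz
      exact (hz.1.sub hz.2).mul_const _
  have hzero : ∀ᵐ x, x ∉ Ω → g x = 0 := by
    filter_upwards [hae', ae_all_iff.2 fun j => (u (φ (ψ j))).ae_eq_zero] with x hx h0 hxΩ
    refine tendsto_nhds_unique hx ?_
    simp only [h0 _ hxΩ]
    exact tendsto_const_nhds
  exact ⟨⟨g, hgag.trans_lt ENNReal.ofReal_lt_top, hzero⟩, fun j => φ (ψ j), hφ.comp hψ,
    hg.comp hψ.tendsto_atTop, hae'⟩

end

end FracPLap

/-! ### Application to the fractional functional. -/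

theorem proposition4 (N : ℕ) [NeZero N] (s p : ℝ) [Fact (1 < p)] (hs0 : 0 < s) (hs1 : s < 1)
    (hsp : s * p < N) (Ω : Set (EuclideanSpace ℝ (Fin N))) (hΩ : IsOpen Ω) (hΩne : Ω.Nonempty)
    (hΩb : Bornology.IsBounded Ω) (lam c : ℝ)
    (hc : c < s / N * (FracPLap.bestConst N s p Ω) ^ ((N : ℝ) / (s * p))) :
    FracPLap.SatisfiesPS (FracPLap.energy N s p Ω lam) c := by
  open FracPLap in
  have hp : 1 < p := Fact.out
  have hp0 : 0 < p := by linarith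
  have hN : 0 < N := Nat.pos_of_neZero N
  have hNR : (0 : ℝ) < N := by exact_mod_cast hN
  have hD : (N : ℝ) - s * p ≠ 0 := by linarith
  have hpq := lt_critExp hs0 hsp hp0
  obtain ⟨K, hK, hsob⟩ := exists_eLpNorm_critExp_le hs0 hp hsp hN
  obtain ⟨K', hK', hhol⟩ := exists_eLpNorm_le_eLpNorm (N := N) (s := s) hΩ.measurableSet hΩb hpq
  have _i1 : Fact (1 ≤ ENNReal.ofReal p) := one_le_ofReal_of_fact
  have _i2 : Fact (1 ≤ ENNReal.ofReal (critExp N s p)) := ⟨by simpa using (hp.trans hpq).le⟩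
  have hsob' : ∀ u : X N s p Ω, eLpNorm u.toFun (ENNReal.ofReal (critExp N s p)) volume ≤
      K * gagliardo s p u.toFun := fun u => hsob _ u.memLp
  -- Hölder on Ω followed by Sobolev gives a Poincaré inequality, hence the continuity of T₂.
  have hemb : ∀ u : X N s p Ω, eLpNorm u.toFun (ENNReal.ofReal p) volume ≤
      (K' * K) * gagliardo s p u.toFun := fun u => by
    refine (hhol u).trans ?_
    rw [mul_assoc]
    gcongr
    exact hsob' u
  set T₂ := X.toLpL p (ENNReal.mul_ne_top hK' hK) hemb with hT₂
  set T₃ := X.toLpL (critExp N s p) hK hsob' with hT₃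
  have hT₂eq : ∀ u, T₂ u = u.toLp := fun u => Lp.ext (X.coeFn_toLpL u)
  -- These two identities match the abstract threshold (1/p − 1/q) S^(q/(q − p)) with (s/N)
  -- S^(N/(sp)).
  have hexp1 : 1 / p - 1 / critExp N s p = s / N := by
    rw [critExp]; field_simp; ring
  have hexp2 : critExp N s p / (critExp N s p - p) = N / (s * p) := by
    have e : critExp N s p - p = s * p * p / (N - s * p) := by
      rw [critExp, div_sub' hD, div_left_inj' hD]; ring
    rw [e, critExp, div_div_div_cancel_right₀ hD]
    field_simp
  rw [← hexp1, ← hexp2] at hc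
  have main := satisfiesPS_of_compact hp hpq (X.diffQuotL (N := N) (s := s) (Ω := Ω)) T₂ T₃ lam
    X.norm_diffQuotL (K := K'.toReal) bestConst_nonneg
    (fun u => by rw [hT₃, X.norm_toLpL]; exact bestConst_mul_le u) ENNReal.toReal_nonneg
    (fun u => ?_) (fun u R hR => ?_) hc
  · simp only [hT₂, hT₃, X.norm_toLpL] at main
    exact main
  · rw [Lp.norm_def, Lp.norm_def, ← ENNReal.toReal_mul, eLpNorm_congr_ae (X.coeFn_toLpL u),
      eLpNorm_congr_ae (X.coeFn_toLpL u)]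
    exact ENNReal.toReal_mono (ENNReal.mul_ne_top hK' (ne_top_of_le_ne_top
      (ENNReal.mul_ne_top hK u.gagliardo_ne_top) (hsob' u))) (hhol u)
  · obtain ⟨w, φ, hφ, hlim, hae⟩ := X.exists_subseq_tendsto hs0 hΩb (C := ‖T₂‖)
      (fun u => by rw [← hT₂eq]; exact T₂.le_opNorm u) (norm_nonneg _) u hR
    refine ⟨w, φ, hφ, ?_, ?_, ?_, ?_⟩
    · filter_upwards [ae_fst_snd hae, X.coeFn_diffQuotL w,
        ae_all_iff.2 fun j => X.coeFn_diffQuotL (u (φ j))] with z hz hw hj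
      simp only [hw, hj]
      exact (hz.1.sub hz.2).mul_const _
    · simpa only [hT₂eq] using hlim
    · simp only [hT₂eq]
      exact hae
    · filter_upwards [hae, X.coeFn_toLpL (hK := hK) (h := hsob') w,
        ae_all_iff.2 fun j => X.coeFn_toLpL (hK := hK) (h := hsob') (u (φ j))] with x hx hw hj
      simp only [hT₃, hw, hj]
      exact hx
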